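/- Let $T^{2}=\mathbb{C}/(\mathbb{Z}+i\mathbb{Z})$ and let $S^{2}=\mathbb{C}\cup\{\infty\}$ be the Riemann sphere with its usual (great circle) distance $d$, where $\mathbb{C}\cup\{\infty\}$ is identified with the unit sphere of $\mathbb{R}^{3}$ by stereographic projection. Let $M_{2}$ be the set of degree $2$ elliptic functions, that is, of holomorphic maps $W:T^{2}\to S^{2}$ that take every value exactly twice, counted with multiplicity, with the topology of the metric $D(V,W)=\sup_{z\in T^{2}}d(V(z),W(z))$. Let $G=PSL(2,\mathbb{C})\times T^{2}$, with the product $(M_1,s_1)(M_2,s_2)=(M_1M_2,s_1+s_2)$ and the product topology; $G$ acts on maps $W:T^{2}\to S^{2}$ by $W_{(M,s)}(z)=M\odot W(z-s)$, where $M\odot w=(a_{11}w+a_{12})/(a_{21}w+a_{22})$ is the Möbius transformation given by $M=(a_{ij})$. Let $\wp$ be the Weierstrass function of the lattice $\mathbb{Z}+i\mathbb{Z}$, $e_{1}=\wp(1/2)$, and $$G_{0}=\{(I,0),(U_{0},s_{0}),(U_{1},s_{1}),(U_{2},s_{2})\}\subset G,$$ where $s_{0}=\frac{1+i}{2}$,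 $s_{1}=\frac12$, $s_{2}=\frac{i}{2}$ and $$U_{0}=\begin{pmatrix}0&1\\-1&0\end{pmatrix},\qquad U_{1}=\frac{i}{\sqrt2}\begin{pmatrix}1&1\\1&-1\end{pmatrix},\qquad U_{2}=\frac{i}{\sqrt2}\begin{pmatrix}-1&1\\1&1\end{pmatrix}.$$ Theorem 1. $G_{0}$ is a subgroup of $G$, it is a Klein four-group, and it is the stabilizer of $\wp/e_{1}$ in $G$. The map $$\phi:G/G_{0}\to M_{2},\qquad \phi_{[(M,s)]}(z)=M\odot\left(\frac{\wp(z-s)}{e_{1}}\right),$$ from the space of left cosets of $G_{0}$ with the quotient topology, is well defined, bijective, and a homeomorphism. -/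

import Mathlib

noncomputable section

namespace EllipticModuli

open Complex

/-! ### The torus `ℂ / (ℤ + iℤ)` -/

/-- The pair of periods `1, i`. -/
def gaussPeriods : PeriodPair where
  ω₁ := 1
  ω₂ := I
  indep := by
    rw [LinearIndependent.pair_iff]
    intro s t h
    have hre := congrArg Complex.re h
    have him := congrArg Complex.im h
    simp at hre him
    exact ⟨hre, him⟩

/-- The torus `T² = ℂ / Ω`, with `Ω = ℤ + iℤ`, as an additive topological group. -/
abbrev Torus : Type := ℂ ⧸ gaussPeriods.lattice.toAddSubgroup

/-! ### The sphere `S² = ℂ ∪ {∞}` and its metric -/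

/-- Inverse stereographic projection from `ℂ ∪ {∞}` to the unit sphere of `ℝ³`
(with `∞` going to the north pole). -/
def toSphere : OnePoint ℂ → EuclideanSpace ℝ (Fin 3)
  | none => !₂[0, 0, 1]
  | some u => !₂[2 * u.re / (1 + normSq u), 2 * u.im / (1 + normSq u),
      (normSq u - 1) / (1 + normSq u)]

/-- The usual (great circle) distance on `S²`. -/
def sphereDist (v w : OnePoint ℂ) : ℝ :=
  InnerProductGeometry.angle (toSphere v) (toSphere w)

lemma norm_toSphere (w : OnePoint ℂ) : ‖toSphere w‖ = 1 := by
  induction w using OnePoint.rec with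
  | infty =>
    change ‖(!₂[0, 0, 1] : EuclideanSpace ℝ (Fin 3))‖ = 1
    simp [EuclideanSpace.norm_eq, Fin.sum_univ_three]
  | coe u =>
    change ‖(!₂[2 * u.re / (1 + normSq u), 2 * u.im / (1 + normSq u),
      (normSq u - 1) / (1 + normSq u)] : EuclideanSpace ℝ (Fin 3))‖ = 1
    have h : (1 + normSq u) ≠ 0 := by have := normSq_nonneg u; positivity
    rw [EuclideanSpace.norm_eq, Real.sqrt_eq_one]
    simp only [Fin.sum_univ_three, Real.norm_eq_abs, sq_abs]
    simp only [Matrix.cons_val_zero, Matrix.cons_val_one, Matrix.cons_val]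
    field_simp
    rw [normSq_apply]
    ring

lemma toSphere_injective : Function.Injective toSphere := by
  have key : ∀ u : ℂ, (1 + normSq u) ≠ 0 := fun u => by
    have := normSq_nonneg u; positivity
  have hinf : ∀ u : ℂ, (normSq u - 1) / (1 + normSq u) ≠ 1 := fun u h => by
    rw [div_eq_one_iff_eq (key u)] at h; linarith
  intro v w h
  induction v using OnePoint.rec with
  | infty =>
    induction w using OnePoint.rec with
    | infty => rfl
    | coe u =>
      have h2 : (1 : ℝ) = (normSq u - 1) / (1 + normSq u) := congrArg (fun x => x 2) h
      exact absurd h2.symm (hinf u)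
  | coe a =>
    induction w using OnePoint.rec with
    | infty =>
      have h2 : (normSq a - 1) / (1 + normSq a) = (1 : ℝ) := congrArg (fun x => x 2) h
      exact absurd h2 (hinf a)
    | coe b =>
      have h0 : 2 * a.re / (1 + normSq a) = 2 * b.re / (1 + normSq b) :=
        congrArg (fun x => x 0) h
      have h1 : 2 * a.im / (1 + normSq a) = 2 * b.im / (1 + normSq b) :=
        congrArg (fun x => x 1) h
      have h2 : (normSq a - 1) / (1 + normSq a) = (normSq b - 1) / (1 + normSq b) :=
        congrArg (fun x => x 2) h
      have hn : normSq a = normSq b := by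
        rw [div_eq_div_iff (key a) (key b)] at h2; linarith
      rw [hn] at h0 h1
      have hk := key b
      congr 1
      apply Complex.ext
      · field_simp at h0; linarith
      · field_simp at h1; linarith

lemma sphereDist_self (v : OnePoint ℂ) : sphereDist v v = 0 := by
  apply InnerProductGeometry.angle_self
  intro h
  have := norm_toSphere v
  rw [h] at this
  simp at this

lemma eq_of_sphereDist_eq_zero {v w : OnePoint ℂ} (h : sphereDist v w = 0) : v = w := by
  apply toSphere_injective
  have h1 : inner ℝ (toSphere v) (toSphere w) = (1 : ℝ) := by
    have := InnerProductGeometry.inner_eq_mul_norm_of_angle_eq_zero h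
    simpa [norm_toSphere] using this
  exact (inner_eq_one_iff_of_norm_eq_one (norm_toSphere v) (norm_toSphere w)).1 h1

/-! ### Elliptic functions as holomorphic maps `T² → S²`, and their degree -/

/-- The standard holomorphic coordinate of `S²` centred at the point `w₀`: it is `w ↦ w - w₀` if
`w₀ ≠ ∞` and `w ↦ 1 / w` if `w₀ = ∞`. It is a chart on `S² ∖ {∞}`, respectively on `S² ∖ {0}`,
and takes the irrelevant value `0` at the excluded point. -/
def coordAt : OnePoint ℂ → OnePoint ℂ → ℂ
  | some a, some w => w - a
  | some _, none => 0
  | none, some w => w⁻¹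
  | none, none => 0

/-- `W` read near the point `p` of the torus, in the coordinate `u` (with `u = 0` at `p`) coming
from the covering `ℂ → T²` and in the coordinate of `S²` centred at `W p`. -/
def localRep (W : Torus → OnePoint ℂ) (p : Torus) (u : ℂ) : ℂ :=
  coordAt (W p) (W (p + (u : Torus)))

/-- `W : T² → S²` is an elliptic function: a continuous map, holomorphic in local coordinates. -/
def IsElliptic (W : Torus → OnePoint ℂ) : Prop :=
  Continuous W ∧ ∀ p, AnalyticAt ℂ (localRep W p) 0

/-- The valency (multiplicity) with which `W` takes the value `W p` at `p`. -/
def valency (W : Torus → OnePoint ℂ) (p : Torus) : ℕ∞ :=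
  analyticOrderAt (localRep W p) 0

/-- `W` has degree `n`: it takes every value in `S²` exactly `n` times, counted with valency.
(A finite sum over an infinite fibre is `0` by convention; this occurs
only for constant `W`, whose degree is indeed `0`.) -/
def HasDegree (W : Torus → OnePoint ℂ) (n : ℕ) : Prop :=
  ∀ w : OnePoint ℂ, ∑ᶠ p ∈ {p : Torus | W p = w}, valency W p = n

/-- The moduli space `M₂` of elliptic functions of degree two. -/
@[ext]
structure M₂ : Type where
  /-- the underlying map -/
  toFun : Torus → OnePoint ℂ
  elliptic : IsElliptic toFun
  degree : HasDegree toFun 2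

instance : CoeFun M₂ (fun _ => Torus → OnePoint ℂ) := ⟨M₂.toFun⟩

lemma bddAbove_sphereDist (V W : Torus → OnePoint ℂ) :
    BddAbove (Set.range fun z => sphereDist (V z) (W z)) :=
  ⟨Real.pi, by rintro _ ⟨z, rfl⟩; exact InnerProductGeometry.angle_le_pi _ _⟩

/-- `M₂` carries the metric `D(V, W) = sup_{z ∈ T²} d(V(z), W(z))`, with `d` the distance
on `S²`. -/
instance : MetricSpace M₂ where
  dist V W := ⨆ z : Torus, sphereDist (V z) (W z)
  dist_self V := by simp [sphereDist_self]
  dist_comm V W := by simp [sphereDist, InnerProductGeometry.angle_comm]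
  dist_triangle U V W := by
    refine ciSup_le fun z => ?_
    exact (InnerProductGeometry.angle_le_angle_add_angle _ (toSphere (V z)) _).trans
      (add_le_add (le_ciSup (bddAbove_sphereDist U V) z) (le_ciSup (bddAbove_sphereDist V W) z))
  eq_of_dist_eq_zero {V W} h := by
    apply M₂.ext
    funext z
    apply eq_of_sphereDist_eq_zero
    exact le_antisymm ((le_ciSup (bddAbove_sphereDist V W) z).trans h.le)
      (InnerProductGeometry.angle_nonneg _ _)

/-! ### Möbius transformations and the group `G = PSL(2, ℂ) × T²` -/

/-- `SL(2, ℂ)`. -/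
abbrev SL2 : Type := Matrix.SpecialLinearGroup (Fin 2) ℂ

/-- `PSL(2, ℂ)`, with the quotient topology. -/
abbrev PSL2 : Type := Matrix.ProjectiveSpecialLinearGroup (Fin 2) ℂ

/-- The action of `SL(2, ℂ)` on `S² = ℂ ∪ {∞}` by Möbius transformations
`w ↦ (a₁₁ w + a₁₂) / (a₂₁ w + a₂₂)`. -/
def moebiusSL : SL2 →* Equiv.Perm (OnePoint ℂ) :=
  (MulAction.toPermHom (GL (Fin 2) ℂ) (OnePoint ℂ)).comp Matrix.SpecialLinearGroup.toGL

lemma moebiusSL_coe (A : SL2) (w : ℂ) :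
    moebiusSL A (w : OnePoint ℂ) =
      if A.1 1 0 * w + A.1 1 1 = 0 then OnePoint.infty
      else (((A.1 0 0 * w + A.1 0 1) / (A.1 1 0 * w + A.1 1 1) : ℂ) : OnePoint ℂ) :=
  OnePoint.smul_some_eq_ite

lemma moebiusSL_infty (A : SL2) :
    moebiusSL A OnePoint.infty =
      if A.1 1 0 = 0 then OnePoint.infty
      else ((A.1 0 0 / A.1 1 0 : ℂ) : OnePoint ℂ) :=
  OnePoint.smul_infty_eq_ite _

lemma center_le_ker_moebiusSL : Subgroup.center SL2 ≤ moebiusSL.ker := by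
  intro A hA
  obtain ⟨r, hr, hA⟩ := Matrix.SpecialLinearGroup.mem_center_iff.1 hA
  have hr0 : r ≠ 0 := by rintro rfl; simp at hr
  have h00 : A.1 0 0 = r := by rw [← hA]; simp
  have h01 : A.1 0 1 = 0 := by rw [← hA]; simp
  have h10 : A.1 1 0 = 0 := by rw [← hA]; simp
  have h11 : A.1 1 1 = r := by rw [← hA]; simp
  rw [MonoidHom.mem_ker]
  ext w : 1
  induction w using OnePoint.rec with
  | infty => rw [moebiusSL_infty, if_pos h10]; rfl
  | coe w =>
    rw [moebiusSL_coe, h00, h01, h10, h11]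
    simp [hr0]

/-- The action `(M, w) ↦ M ⊙ w` of `PSL(2, ℂ)` on `S²` by Möbius transformations. -/
def moebius : PSL2 →* Equiv.Perm (OnePoint ℂ) :=
  QuotientGroup.lift _ moebiusSL center_le_ker_moebiusSL

/-- The topological group `G = PSL(2, ℂ) × T²`, with product
`(M, s) (N, t) = (M N, s + t)` and the product topology. -/
abbrev G : Type := PSL2 × Multiplicative Torus

/-- The element `(M, s)` of `G`. -/
def G.mk (M : PSL2) (s : Torus) : G := (M, Multiplicative.ofAdd s)

/-- The action of `G` on maps `T² → S²`: `W_{(M, s)}(z) = M ⊙ W(z - s)`. -/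
def act (g : G) (W : Torus → OnePoint ℂ) : Torus → OnePoint ℂ :=
  fun z => moebius g.1 (W (z - g.2.toAdd))

/-! ### The function `℘ / e₁` and the group `G₀` -/

/-- `e₁ = ℘(1/2)`. -/
def e₁ : ℂ := gaussPeriods.weierstrassP (1 / 2)

open Classical in
/-- The map `℘ / e₁ : T² → S²`, equal to `∞` at the lattice points. -/
def wpNormalized : Torus → OnePoint ℂ :=
  Quotient.lift
    (fun z : ℂ => if z ∈ gaussPeriods.lattice then (OnePoint.infty : OnePoint ℂ)
      else ((gaussPeriods.weierstrassP z / e₁ : ℂ) : OnePoint ℂ))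
    (by
      intro a b hab
      have h : -a + b ∈ gaussPeriods.lattice := QuotientAddGroup.leftRel_apply.1 hab
      have hb : b = a + (-a + b) := by ring
      have hiff : a ∈ gaussPeriods.lattice ↔ b ∈ gaussPeriods.lattice := by
        constructor
        · intro ha; rw [hb]; exact add_mem ha h
        · intro hb'; have := sub_mem hb' h; simpa using this
      have hP : gaussPeriods.weierstrassP b = gaussPeriods.weierstrassP a := by
        have := gaussPeriods.weierstrassP_add_coe a ⟨_, h⟩
        rwa [← hb] at this
      simp only [hiff, hP])

lemma sqrt_two_sq : ((Real.sqrt 2 : ℝ) : ℂ) * (Real.sqrt 2 : ℝ) = 2 := by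
  rw [← Complex.ofReal_mul, Real.mul_self_sqrt (by norm_num)]; norm_num

lemma I_div_sq : (I / (Real.sqrt 2 : ℝ)) * (I / (Real.sqrt 2 : ℝ)) = -(1 / 2 : ℂ) := by
  rw [div_mul_div_comm, sqrt_two_sq, I_mul_I]; norm_num

/-- `U₀ = [[0, 1], [-1, 0]]`. -/
def U₀ : SL2 := ⟨!![0, 1; -1, 0], by simp [Matrix.det_fin_two_of]⟩

/-- `U₁ = (i / √2) [[1, 1], [1, -1]]`. -/
def U₁ : SL2 := ⟨(I / (Real.sqrt 2 : ℝ)) • !![1, 1; 1, -1], by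
  rw [Matrix.det_smul, Fintype.card_fin, Matrix.det_fin_two_of, sq, I_div_sq]; norm_num⟩

/-- `U₂ = (i / √2) [[-1, 1], [1, 1]]`. -/
def U₂ : SL2 := ⟨(I / (Real.sqrt 2 : ℝ)) • !![-1, 1; 1, 1], by
  rw [Matrix.det_smul, Fintype.card_fin, Matrix.det_fin_two_of, sq, I_div_sq]; norm_num⟩

/-- `s₀ = (1 + i) / 2`. -/
def s₀ : Torus := (((1 + I) / 2 : ℂ) : Torus)

/-- `s₁ = 1 / 2`. -/
def s₁ : Torus := ((1 / 2 : ℂ) : Torus)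

/-- `s₂ = i / 2`. -/
def s₂ : Torus := ((I / 2 : ℂ) : Torus)

/-- `(U₀, s₀)`. -/
def g₀ : G := G.mk (QuotientGroup.mk U₀) s₀

/-- `(U₁, s₁)`. -/
def g₁ : G := G.mk (QuotientGroup.mk U₁) s₁

/-- `(U₂, s₂)`. -/
def g₂ : G := G.mk (QuotientGroup.mk U₂) s₂

lemma PSL2.mk_eq_mk_of_neg {A B : SL2} (h : A = -B) :
    (QuotientGroup.mk A : PSL2) = QuotientGroup.mk B := by
  subst h
  rw [QuotientGroup.eq, Matrix.SpecialLinearGroup.mem_center_iff]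
  refine ⟨-1, by simp, ?_⟩
  have : (-B)⁻¹ * B = -1 := by rw [inv_mul_eq_iff_eq_mul]; simp
  rw [this]
  ext i j
  fin_cases i <;> fin_cases j <;> simp

lemma one_mem_lattice : (1 : ℂ) ∈ gaussPeriods.lattice := gaussPeriods.ω₁_mem_lattice

lemma I_mem_lattice : I ∈ gaussPeriods.lattice := gaussPeriods.ω₂_mem_lattice

lemma Torus.coe_eq_coe {a b : ℂ} (h : -a + b ∈ gaussPeriods.lattice) :
    (a : Torus) = (b : Torus) := QuotientAddGroup.eq.2 h

lemma g₀_mul_self : g₀ * g₀ = 1 := by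
  refine Prod.ext ?_ ?_
  · change (QuotientGroup.mk (U₀ * U₀) : PSL2) = QuotientGroup.mk 1
    apply PSL2.mk_eq_mk_of_neg
    apply Subtype.ext
    change !![(0 : ℂ), 1; -1, 0] * !![0, 1; -1, 0] = -1
    ext i j
    fin_cases i <;> fin_cases j <;> simp
  · change (((1 + I) / 2 + (1 + I) / 2 : ℂ) : Torus) = ((0 : ℂ) : Torus)
    apply Torus.coe_eq_coe
    convert neg_mem (add_mem one_mem_lattice I_mem_lattice) using 1
    ring

lemma g₁_mul_self : g₁ * g₁ = 1 := by
  refine Prod.ext ?_ ?_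
  · change (QuotientGroup.mk (U₁ * U₁) : PSL2) = QuotientGroup.mk 1
    apply PSL2.mk_eq_mk_of_neg
    apply Subtype.ext
    change ((I / (Real.sqrt 2 : ℝ)) • !![(1 : ℂ), 1; 1, -1]) *
      ((I / (Real.sqrt 2 : ℝ)) • !![1, 1; 1, -1]) = -1
    rw [smul_mul_smul_comm, I_div_sq]
    ext i j
    fin_cases i <;> fin_cases j <;> simp <;> norm_num
  · change ((1 / 2 + 1 / 2 : ℂ) : Torus) = ((0 : ℂ) : Torus)
    apply Torus.coe_eq_coe
    convert neg_mem one_mem_lattice using 1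
    ring

lemma g₀_mul_g₁ : g₀ * g₁ = g₂ := by
  refine Prod.ext ?_ ?_
  · change (QuotientGroup.mk (U₀ * U₁) : PSL2) = QuotientGroup.mk U₂
    apply PSL2.mk_eq_mk_of_neg
    apply Subtype.ext
    change !![(0 : ℂ), 1; -1, 0] * ((I / (Real.sqrt 2 : ℝ)) • !![1, 1; 1, -1]) =
      -((I / (Real.sqrt 2 : ℝ)) • !![-1, 1; 1, 1])
    ext i j
    fin_cases i <;> fin_cases j <;> simp [Matrix.mul_apply, Fin.sum_univ_two]
  · change (((1 + I) / 2 + 1 / 2 : ℂ) : Torus) = ((I / 2 : ℂ) : Torus)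
    apply Torus.coe_eq_coe
    convert neg_mem one_mem_lattice using 1
    ring

lemma g₁_mul_g₀ : g₁ * g₀ = g₂ := by
  refine Prod.ext ?_ ?_
  · change (QuotientGroup.mk (U₁ * U₀) : PSL2) = QuotientGroup.mk U₂
    congr 1
    apply Subtype.ext
    change ((I / (Real.sqrt 2 : ℝ)) • !![1, 1; 1, -1]) * !![(0 : ℂ), 1; -1, 0] =
      (I / (Real.sqrt 2 : ℝ)) • !![-1, 1; 1, 1]
    ext i j
    fin_cases i <;> fin_cases j <;> simp [Matrix.mul_apply, Fin.sum_univ_two]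
  · change ((1 / 2 + (1 + I) / 2 : ℂ) : Torus) = ((I / 2 : ℂ) : Torus)
    apply Torus.coe_eq_coe
    convert neg_mem one_mem_lattice using 1
    ring

/-- The subgroup `G₀ = {(I, 0), (U₀, s₀), (U₁, s₁), (U₂, s₂)}` of `G`. -/
def G₀ : Subgroup G where
  carrier := {1, g₀, g₁, g₂}
  one_mem' := by simp
  mul_mem' := by
    have h00 := g₀_mul_self
    have h11 := g₁_mul_self
    have h01 := g₀_mul_g₁
    have h10 := g₁_mul_g₀
    have h02 : g₀ * g₂ = g₁ := by rw [← h01, ← mul_assoc, h00, one_mul]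
    have h12 : g₁ * g₂ = g₀ := by rw [← h10, ← mul_assoc, h11, one_mul]
    have h20 : g₂ * g₀ = g₁ := by rw [← h10, mul_assoc, h00, mul_one]
    have h21 : g₂ * g₁ = g₀ := by rw [← h01, mul_assoc, h11, mul_one]
    have h22 : g₂ * g₂ = 1 := by rw [← h01, mul_assoc, h01, h12, h00]
    rintro a b (rfl | rfl | rfl | rfl) (rfl | rfl | rfl | rfl) <;>
      simp [h00, h11, h01, h10, h02, h12, h20, h21, h22]
  inv_mem' := by
    have h00 := g₀_mul_self
    have h11 := g₁_mul_self
    have h22 : g₂ * g₂ = 1 := by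
      nth_rewrite 1 [← g₀_mul_g₁]
      rw [← g₁_mul_g₀, mul_assoc, ← mul_assoc g₁, h11, one_mul, h00]
    rintro a (rfl | rfl | rfl | rfl)
    · simp
    · rw [inv_eq_of_mul_eq_one_left h00]; simp
    · rw [inv_eq_of_mul_eq_one_left h11]; simp
    · rw [inv_eq_of_mul_eq_one_left h22]; simp

end EllipticModuli

end

open Filter Topology

namespace EllipticModuli

/-! ### Orders of meromorphic functions -/

section Order

variable {f g : ℂ → ℂ} {x : ℂ}

/-! Everything algebraic follows from Liouville's theorem for doubly periodic functions, applied by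
counting orders: no poles implies constant (`exists_const_of_order_nonneg`), and at most one simple
pole modulo periods implies constant (`exists_const_of_simple_pole_at`). The second is obtained from
the first by parity, without residues.

Order counting shows that ℘' has only simple zeros, exactly at the half periods outside the lattice,
that ℘ is onto, and that ℘ a = ℘ b only for b = ±a modulo periods
(`sub_mem_or_add_mem_of_weierstrassP_eq`). So ℘/e₁ has degree two with fibres {p, -p}. Translation
by a half period acts on ℘ by a Möbius involution (`exists_weierstrassP_half_translate`); the
symmetry ℘(iz) = -℘(z) of the square lattice fixes its constants and yields the matrices of `G₀`.
Conversely, evenness of ℘ forces a stabilizing translation to have order at most two, and after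
correction by an element of `G₀` only a Möbius map fixing every point of the sphere remains.

Transitivity (`exists_act_eq`): given W of degree two, a translate of ℘, or of 1/(℘ - ℘ b), is
chosen with the same poles as W. A multiple of it cancels one leading term, and the difference is
constant.

For the topology, the orbit map is continuous because the torus is compact. For the inverse, let
Möbius transforms by A of translates of ℘/e₁ converge to W. The translations accumulate by
compactness, and the matrices rescaled to norm one accumulate at some B ≠ 0. If det B were 0, then W
would be constant off a finite set (`det_ne_zero_of_tendsto`); so det B ≠ 0, the scaling factors
converge, and so do the matrices (`exists_tendsto_SL2`). -/

lemma le_meromorphicOrderAt_sub (hf : MeromorphicAt f x) (hg : MeromorphicAt g x) {n : WithTop ℤ}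
    (hnf : n ≤ meromorphicOrderAt f x) (hng : n ≤ meromorphicOrderAt g x) :
    n ≤ meromorphicOrderAt (fun z => f z - g z) x := by
  have h := meromorphicOrderAt_add hf hg.neg
  rw [← meromorphicOrderAt_neg (f := g)] at h
  have e : (f + -g) = fun z => f z - g z := by ext z; simp [sub_eq_add_neg]
  rw [e] at h
  exact (le_min hnf hng).trans h

lemma le_meromorphicOrderAt_mul (hf : MeromorphicAt f x) (hg : MeromorphicAt g x)
    {m n : WithTop ℤ} (hm : m ≤ meromorphicOrderAt f x) (hn : n ≤ meromorphicOrderAt g x) :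
    m + n ≤ meromorphicOrderAt (fun z => f z * g z) x := by
  rw [fun_meromorphicOrderAt_mul hf hg]
  exact add_le_add hm hn

lemma meromorphicOrderAt_comp_const_sub (f : ℂ → ℂ) (c x : ℂ) :
    meromorphicOrderAt (fun z => f (c - z)) x = meromorphicOrderAt f (c - x) :=
  meromorphicOrderAt_comp_of_deriv_ne_zero (f := f) (g := fun z => c - z) (x := x)
    (by fun_prop) (by simp)

lemma meromorphicOrderAt_comp_neg (f : ℂ → ℂ) (x : ℂ) :
    meromorphicOrderAt (fun z => f (-z)) x = meromorphicOrderAt f (-x) := by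
  simpa using meromorphicOrderAt_comp_const_sub f 0 x

lemma meromorphicOrderAt_comp_add (f : ℂ → ℂ) (c x : ℂ) :
    meromorphicOrderAt (fun z => f (z + c)) x = meromorphicOrderAt f (x + c) :=
  meromorphicOrderAt_fun_comp_add_const_eq_meromorphicOrderAt

lemma meromorphic_comp_add (hf : Meromorphic f) (c : ℂ) : Meromorphic fun z => f (z + c) :=
  fun z => meromorphicAt_comp_add_const_iff_meromorphicAt.2 (hf (z + c))

lemma meromorphic_comp_neg (hf : Meromorphic f) : Meromorphic fun z => f (-z) :=
  fun z => (hf (-z)).comp_analyticAt (by fun_prop)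

/-- Point reflection about its centre preserves punctured neighbourhoods, so a symmetry of a
function passes to its limit there. -/
lemma tendsto_const_sub_nhdsNE (c k : ℂ) (h : c - k = k) :
    Tendsto (fun z => c - z) (𝓝[≠] k) (𝓝[≠] k) := by
  refine tendsto_nhdsWithin_iff.2 ⟨?_, ?_⟩
  · have : ContinuousAt (fun z => c - z) k := by fun_prop
    have h2 := this.tendsto.mono_left (nhdsWithin_le_nhds (s := {k}ᶜ))
    rwa [h] at h2
  · filter_upwards [self_mem_nhdsWithin] with z hz hz'
    apply hz
    simp only [Set.mem_singleton_iff] at hz' ⊢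
    linear_combination -hz' + h

/-- A function which is odd about a point, and without a pole there, has a zero there. -/
lemma meromorphicOrderAt_pos_of_odd (hf : MeromorphicAt f x) (h0 : 0 ≤ meromorphicOrderAt f x)
    (hodd : ∀ z, f (2 * x - z) = -f z) : 1 ≤ meromorphicOrderAt f x := by
  obtain ⟨c, hc⟩ := tendsto_nhds_of_meromorphicOrderAt_nonneg hf h0
  have h1 := hc.comp (tendsto_const_sub_nhdsNE (2 * x) x (by ring))
  have h2 : (f ∘ fun z => 2 * x - z) = fun z => -f z := funext hodd
  rw [h2] at h1
  have h3 : c = -c := tendsto_nhds_unique h1 hc.neg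
  have h4 : c = 0 := by
    have : (2 : ℂ) * c = 0 := by linear_combination h3
    simpa using this
  rw [h4] at hc
  have := (tendsto_zero_iff_meromorphicOrderAt_pos hf).1 hc
  cases h : meromorphicOrderAt f x with
  | top => simp
  | coe n =>
    rw [h] at this
    have : (0 : ℤ) < n := by exact_mod_cast this
    exact_mod_cast (show (1 : ℤ) ≤ n by omega)

/-- If two functions have the same finite order at a point, then a multiple of one cancels the
leading term of the other. -/
lemma exists_lt_meromorphicOrderAt_sub {n : ℤ} (hf : MeromorphicAt f x) (hg : MeromorphicAt g x)
    (hfn : meromorphicOrderAt f x = n) (hgn : meromorphicOrderAt g x = n) :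
    ∃ c : ℂ, c ≠ 0 ∧ ((n + 1 : ℤ) : WithTop ℤ) ≤ meromorphicOrderAt (fun z => f z - c * g z) x := by
  obtain ⟨F, hF, hF0, hfF⟩ := (meromorphicOrderAt_eq_int_iff hf).1 hfn
  obtain ⟨G, hG, hG0, hgG⟩ := (meromorphicOrderAt_eq_int_iff hg).1 hgn
  -- The quotient of the leading Laurent coefficients: the remaining analytic factor then vanishes
  -- at `x`, which gains one order.
  refine ⟨F x / G x, div_ne_zero hF0 hG0, ?_⟩
  have e : (fun z => f z - F x / G x * g z) =ᶠ[𝓝[≠] x]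
      fun z => (z - x) ^ n * (F z - F x / G x * G z) := by
    filter_upwards [hfF, hgG] with z h1 h2
    rw [h1, h2]; simp only [smul_eq_mul]; ring
  have hH : AnalyticAt ℂ (fun z => F z - F x / G x * G z) x := by fun_prop
  have hH0 : (fun z => F z - F x / G x * G z) x = 0 := by simp [hG0]
  rw [meromorphicOrderAt_congr e]
  have h1 : ((n : ℤ) : WithTop ℤ) ≤ meromorphicOrderAt (fun z => (z - x) ^ n) x := by
    exact fun_meromorphicOrderAt_zpow_id_sub_const.ge
  have h2 : ((1 : ℤ) : WithTop ℤ) ≤ meromorphicOrderAt (fun z => F z - F x / G x * G z) x := by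
    rw [hH.meromorphicOrderAt_eq]
    have : (1 : ℕ∞) ≤ analyticOrderAt (fun z => F z - F x / G x * G z) x :=
      Order.one_le_iff_ne_zero.2 (analyticOrderAt_ne_zero.2 ⟨hH, hH0⟩)
    cases h : analyticOrderAt (fun z => F z - F x / G x * G z) x with
    | top => simp
    | coe m =>
      rw [h] at this
      have : 1 ≤ m := by exact_mod_cast this
      simp only [ENat.map_natCast]
      exact_mod_cast this
  have := le_meromorphicOrderAt_mul (f := fun z => (z - x) ^ n)
    (g := fun z => F z - F x / G x * G z) (by fun_prop) hH.meromorphicAt h1 h2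
  simpa using this

/-- Identity theorem: the plane is connected, so infinite order at one point spreads to all. -/
lemma meromorphicOrderAt_eq_top_of_exists (hf : Meromorphic f)
    (h : meromorphicOrderAt f x = ⊤) (y : ℂ) : meromorphicOrderAt f y = ⊤ := by
  by_contra hy
  exact MeromorphicOn.meromorphicOrderAt_ne_top_of_isPreconnected (U := Set.univ)
    (fun z _ => hf z) isPreconnected_univ (Set.mem_univ y) (Set.mem_univ x) hy h

end Order

/-! ### Liouville theorems for doubly periodic functions -/

section Liouville

variable (L : PeriodPair) {f : ℂ → ℂ}

/-- `f` has all elements of the lattice as periods. -/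
def LatticePeriodic (f : ℂ → ℂ) : Prop := ∀ l ∈ L.lattice, ∀ z, f (z + l) = f z

variable {L}

lemma LatticePeriodic.order_eq (hf : LatticePeriodic L f) {l : ℂ} (hl : l ∈ L.lattice) (z : ℂ) :
    meromorphicOrderAt f (z + l) = meromorphicOrderAt f z := by
  rw [← meromorphicOrderAt_comp_add]
  congr 1
  ext w
  exact hf l hl w

lemma LatticePeriodic.comp_add (hf : LatticePeriodic L f) (c : ℂ) :
    LatticePeriodic L fun z => f (z + c) := fun l hl z => by
  have := hf l hl (z + c)
  rwa [add_right_comm] at this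

lemma LatticePeriodic.comp_neg (hf : LatticePeriodic L f) :
    LatticePeriodic L fun z => f (-z) := fun l hl z => by
  have := hf (-l) (neg_mem hl) (-z)
  rwa [← neg_add] at this

lemma LatticePeriodic.sub {g : ℂ → ℂ} (hf : LatticePeriodic L f) (hg : LatticePeriodic L g) :
    LatticePeriodic L fun z => f z - g z := fun l hl z => by
  simp only [hf l hl z, hg l hl z]

lemma LatticePeriodic.mul {g : ℂ → ℂ} (hf : LatticePeriodic L f) (hg : LatticePeriodic L g) :
    LatticePeriodic L fun z => f z * g z := fun l hl z => by
  simp only [hf l hl z, hg l hl z]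

lemma LatticePeriodic.const (c : ℂ) : LatticePeriodic L fun _ => c := fun _ _ _ => rfl

lemma LatticePeriodic.inv (hf : LatticePeriodic L f) :
    LatticePeriodic L fun z => (f z)⁻¹ := fun l hl z => by
  simp only [hf l hl z]

lemma eq_of_eventuallyEq_const {c x : ℂ} (hf : ContinuousAt f x) (h : ∀ᶠ z in 𝓝[≠] x, f z = c) :
    f x = c := by
  have h1 : Tendsto f (𝓝[≠] x) (𝓝 (f x)) := hf.tendsto.mono_left nhdsWithin_le_nhds
  exact tendsto_nhds_unique h1 (tendsto_const_nhds.congr' (h.mono fun z hz => hz.symm))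

/-- A doubly periodic meromorphic function without poles is constant. -/
theorem exists_const_of_order_nonneg (hf : Meromorphic f) (hp : LatticePeriodic L f)
    (h0 : ∀ z, 0 ≤ meromorphicOrderAt f z) : ∃ c : ℂ, ∀ x, ∀ᶠ z in 𝓝[≠] x, f z = c := by
  have hfo : MeromorphicOn f Set.univ := fun z _ => hf z
  -- The normal form repairs the values at removable singularities, so `F` is entire. By continuity
  -- it is periodic everywhere, hence bounded.
  set F := toMeromorphicNFOn f Set.univ with hF
  have hNF : MeromorphicNFOn F Set.univ := meromorphicNFOn_toMeromorphicNFOn f Set.univ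
  have hFf : ∀ x, ∀ᶠ z in 𝓝[≠] x, F z = f z := fun x =>
    hfo.toMeromorphicNFOn_eq_self_on_nhdsNE (Set.mem_univ x)
  have han : ∀ x, AnalyticAt ℂ F x := fun x => by
    apply (hNF (Set.mem_univ x)).meromorphicOrderAt_nonneg_iff_analyticAt.1
    rw [hF, meromorphicOrderAt_toMeromorphicNFOn hfo (Set.mem_univ x)]
    exact h0 x
  have hd : Differentiable ℂ F := fun x => (han x).differentiableAt
  have hper : ∀ z, ∀ w ∈ L.lattice, F (z + w) = F z := by
    intro z w hw
    have h1 : ∀ᶠ u in 𝓝[≠] z, F (u + w) = f (u + w) := by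
      have : Tendsto (fun u => u + w) (𝓝[≠] z) (𝓝[≠] (z + w)) := by
        refine tendsto_nhdsWithin_iff.2 ⟨?_, ?_⟩
        · have : ContinuousAt (fun u => u + w) z := by fun_prop
          exact this.tendsto.mono_left nhdsWithin_le_nhds
        · filter_upwards [self_mem_nhdsWithin] with u hu
          simpa using hu
      exact this.eventually (hFf (z + w))
    have h2 : ∀ᶠ u in 𝓝[≠] z, F (u + w) - F u = 0 := by
      filter_upwards [h1, hFf z] with u hu hu'
      rw [hu, hu', hp w hw, sub_self]
    have hc : ContinuousAt (fun u => F (u + w) - F u) z := by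
      have := hd.continuous
      fun_prop
    exact sub_eq_zero.1 (eq_of_eventuallyEq_const (f := fun u => F (u + w) - F u) hc h2)
  have hb := (IsZLattice.isCompact_range_of_periodic L.lattice _ hd.continuous
    fun z w hw => hper z w hw).isBounded
  refine ⟨F 0, fun x => ?_⟩
  filter_upwards [hFf x] with z hz
  rw [← hz, hd.apply_eq_apply_of_bounded hb z 0]

/-- A function generically equal to a constant differs from it by a function of infinite order. -/
lemma order_const_sub_eq_top {c x : ℂ} (h : ∀ᶠ z in 𝓝[≠] x, f z = c) :
    meromorphicOrderAt (fun z => f z - c) x = ⊤ := by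
  rw [meromorphicOrderAt_eq_top_iff]
  filter_upwards [h] with z hz
  rw [hz, sub_self]

/-- A doubly periodic function with at most one simple pole modulo periods is constant. -/
theorem exists_const_of_simple_pole (hf : Meromorphic f) (hp : LatticePeriodic L f)
    (h0 : ∀ z, z ∉ L.lattice → 0 ≤ meromorphicOrderAt f z) (h1 : -1 ≤ meromorphicOrderAt f 0) :
    ∃ c : ℂ, ∀ x, ∀ᶠ z in 𝓝[≠] x, f z = c := by
  have hfn := meromorphic_comp_neg hf
  -- This odd function has at most simple poles, all on the lattice, and it vanishes at the half
  -- periods outside the lattice.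
  set o : ℂ → ℂ := fun z => f z - f (-z) with ho
  have hom : Meromorphic o := fun z => (hf z).sub (hfn z)
  have hop : LatticePeriodic L o := hp.sub hp.comp_neg
  have hodd : ∀ z, o (-z) = -o z := fun z => by simp [ho]
  have hf1 : ∀ z, z ∈ L.lattice → -1 ≤ meromorphicOrderAt f z := fun z hz => by
    rw [← zero_add z, hp.order_eq hz]; exact h1
  have ho0 : ∀ z, z ∉ L.lattice → 0 ≤ meromorphicOrderAt o z := fun z hz => by
    refine le_meromorphicOrderAt_sub (hf z) (hfn z) (h0 z hz) ?_
    rw [meromorphicOrderAt_comp_neg]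
    exact h0 _ (by simpa using hz)
  have ho1 : ∀ z, z ∈ L.lattice → -1 ≤ meromorphicOrderAt o z := fun z hz => by
    refine le_meromorphicOrderAt_sub (hf z) (hfn z) (hf1 z hz) ?_
    rw [meromorphicOrderAt_comp_neg]
    exact hf1 _ (neg_mem hz)
  have hhalf : ∀ z, 2 * z ∈ L.lattice → z ∉ L.lattice → 1 ≤ meromorphicOrderAt o z := by
    intro z hz2 hz
    refine meromorphicOrderAt_pos_of_odd (hom z) (ho0 z hz) fun w => ?_
    rw [← hodd, ← hop _ hz2 (-w)]; congr 1; ring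
  set a := L.ω₁ / 2 with ha
  set b := L.ω₂ / 2 with hb
  have ha2 : 2 * a ∈ L.lattice := by
    rw [ha, mul_div_cancel₀ _ two_ne_zero]; exact L.ω₁_mem_lattice
  have hb2 : 2 * b ∈ L.lattice := by
    rw [hb, mul_div_cancel₀ _ two_ne_zero]; exact L.ω₂_mem_lattice
  have haL : a ∉ L.lattice := L.ω₁_div_two_notMem_lattice
  have hbL : b ∉ L.lattice := L.ω₂_div_two_notMem_lattice
  have hsh := meromorphic_comp_add hom a
  have hba : b + a ∉ L.lattice := by
    have := L.mul_ω₁_add_mul_ω₂_mem_lattice (α := 1 / 2) (β := 1 / 2)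
    rw [show b + a = ((1 / 2 : ℚ) : ℂ) * L.ω₁ + ((1 / 2 : ℚ) : ℂ) * L.ω₂ by
      rw [ha, hb]; push_cast; ring, this]
    rintro ⟨h, -⟩
    norm_num at h
  -- The shift by `a` puts a zero of each factor on the possible poles of the other, so `P` is
  -- constant. It vanishes at the other half period `b`, hence `P` and then `o` vanish generically.
  set P : ℂ → ℂ := fun z => o z * o (z + a) with hP
  have hPm : Meromorphic P := fun z => (hom z).mul (hsh z)
  have hPp : LatticePeriodic L P := hop.mul (hop.comp_add a)
  have hP0 : ∀ z, 0 ≤ meromorphicOrderAt P z := by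
    intro z
    have hshift := meromorphicOrderAt_comp_add o a z
    by_cases hz : z ∈ L.lattice
    · have h2 : 1 ≤ meromorphicOrderAt o (z + a) := by
        apply hhalf
        · rw [mul_add, two_mul]; exact add_mem (add_mem hz hz) ha2
        · intro h; exact haL (by simpa using sub_mem h hz)
      have := le_meromorphicOrderAt_mul (hom z) (hsh z) (ho1 z hz) (hshift ▸ h2)
      simpa using this
    by_cases hza : z + a ∈ L.lattice
    · have h2 : 1 ≤ meromorphicOrderAt o z := by
        apply hhalf _ _ hz
        have := sub_mem (add_mem hza hza) ha2
        convert this using 1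
        ring
      have := le_meromorphicOrderAt_mul (hom z) (hsh z) h2 (hshift ▸ ho1 _ hza)
      simpa using this
    · have := le_meromorphicOrderAt_mul (hom z) (hsh z) (ho0 z hz) (hshift ▸ ho0 _ hza)
      simpa using this
  obtain ⟨c, hc⟩ := exists_const_of_order_nonneg hPm hPp hP0
  have hPb : 0 < meromorphicOrderAt P b := by
    have := le_meromorphicOrderAt_mul (hom b) (hsh b) (hhalf b hb2 hbL)
      ((meromorphicOrderAt_comp_add o a b) ▸ ho0 _ hba)
    refine lt_of_lt_of_le ?_ this
    simp
  have hc0 : c = 0 := by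
    have h1 := (tendsto_zero_iff_meromorphicOrderAt_pos (hPm b)).2 hPb
    exact tendsto_nhds_unique (tendsto_const_nhds.congr' ((hc b).mono fun z hz => hz.symm)) h1
  have hotop : ∀ z, meromorphicOrderAt o z = ⊤ := by
    have h1 : meromorphicOrderAt P b = ⊤ := by
      rw [meromorphicOrderAt_eq_top_iff]
      simpa [hc0] using hc b
    rw [hP, fun_meromorphicOrderAt_mul (hom b) (hsh b), WithTop.add_eq_top] at h1
    rcases h1 with h1 | h1
    · exact meromorphicOrderAt_eq_top_of_exists hom h1
    · rw [meromorphicOrderAt_comp_add] at h1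
      exact meromorphicOrderAt_eq_top_of_exists hom h1
  -- Now `f` is even near 0, off 0 itself. A simple pole is impossible, since its leading
  -- coefficient would equal its own negative.
  have hf00 : 0 ≤ meromorphicOrderAt f 0 := by
    by_contra hneg
    have hm1 : meromorphicOrderAt f 0 = ((-1 : ℤ) : WithTop ℤ) := by
      cases h : meromorphicOrderAt f 0 with
      | top => simp [h] at hneg
      | coe n =>
        rw [h] at h1 hneg
        have h1' : (-1 : ℤ) ≤ n := WithTop.coe_le_coe.1 h1
        have h2' : ¬ (0 : ℤ) ≤ n := by exact_mod_cast hneg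
        congr 1
        omega
    obtain ⟨g, hg, hg0, hfg⟩ := (meromorphicOrderAt_eq_int_iff (hf 0)).1 hm1
    have hneg' : Tendsto (fun z : ℂ => -z) (𝓝[≠] 0) (𝓝[≠] 0) := by
      simpa using tendsto_const_sub_nhdsNE 0 0 (by simp)
    have hev := meromorphicOrderAt_eq_top_iff.1 (hotop 0)
    have hz : ∀ᶠ z in 𝓝[≠] (0 : ℂ), g z + g (-z) = 0 := by
      filter_upwards [hfg, hneg'.eventually hfg, hev, self_mem_nhdsWithin] with z h1 h2 h3 h4
      have h4 : z ≠ 0 := h4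
      simp only [ho] at h3
      rw [h1, h2] at h3
      simp only [smul_eq_mul, sub_zero, zpow_neg_one] at h3
      field_simp at h3
      linear_combination h3
    have hcont : ContinuousAt (fun z => g z + g (-z)) 0 := by
      have h1 := hg.continuousAt
      have h2 : ContinuousAt (fun z => g (-z)) 0 :=
        ContinuousAt.comp (f := fun z : ℂ => -z) (g := g) (by simpa using h1) (by fun_prop)
      exact h1.add h2
    have := eq_of_eventuallyEq_const (f := fun z => g z + g (-z)) hcont hz
    simp only [neg_zero] at this
    apply hg0
    have h2 : (2 : ℂ) * g 0 = 0 := by linear_combination this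
    simpa using h2
  refine exists_const_of_order_nonneg hf hp fun z => ?_
  by_cases hz : z ∈ L.lattice
  · rw [← zero_add z, hp.order_eq hz]; exact hf00
  · exact h0 z hz

/-- A doubly periodic function with at most one simple pole modulo periods is constant. -/
theorem exists_const_of_simple_pole_at (hf : Meromorphic f) (hp : LatticePeriodic L f) (q : ℂ)
    (h0 : ∀ z, z - q ∉ L.lattice → 0 ≤ meromorphicOrderAt f z)
    (h1 : -1 ≤ meromorphicOrderAt f q) :
    ∃ c : ℂ, ∀ x, ∀ᶠ z in 𝓝[≠] x, f z = c := by
  obtain ⟨c, hc⟩ := exists_const_of_simple_pole (meromorphic_comp_add hf q) (hp.comp_add q)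
    (fun z hz => by
      rw [meromorphicOrderAt_comp_add]
      exact h0 _ (by simpa using hz))
    (by rw [meromorphicOrderAt_comp_add, zero_add]; exact h1)
  refine ⟨c, fun x => ?_⟩
  have h := order_const_sub_eq_top (hc (x - q))
  have e := meromorphicOrderAt_comp_add (fun z => f z - c) q (x - q)
  rw [sub_add_cancel] at e
  rw [e, meromorphicOrderAt_eq_top_iff] at h
  filter_upwards [h] with z hz
  exact sub_eq_zero.1 hz

end Liouville

end EllipticModuli

open Filter Topology

namespace EllipticModuli

/-! ### Generically constant functions -/

section Constant

variable {f : ℂ → ℂ} {c x : ℂ}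

lemma meromorphicOrderAt_eq_zero_of_const (h : ∀ᶠ z in 𝓝[≠] x, f z = c) (hc : c ≠ 0) :
    meromorphicOrderAt f x = 0 := by
  classical
  rw [meromorphicOrderAt_congr (f₂ := fun _ => c) h, meromorphicOrderAt_const, if_neg hc]

/-- Shows that the constants produced by Liouville's theorem are nonzero. -/
lemma const_ne_zero_of_order_ne_top (h : ∀ᶠ z in 𝓝[≠] x, f z = c)
    (hx : meromorphicOrderAt f x ≠ ⊤) : c ≠ 0 := by
  rintro rfl
  exact hx (meromorphicOrderAt_eq_top_iff.2 h)

lemma le_meromorphicOrderAt_const (c x : ℂ) : 0 ≤ meromorphicOrderAt (fun _ : ℂ => c) x :=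
  AnalyticAt.meromorphicOrderAt_nonneg analyticAt_const

end Constant

/-! ### Zeros and poles of `℘` and its derivative -/

section Weierstrass

variable (L : PeriodPair)

lemma latticePeriodic_weierstrassP : LatticePeriodic L L.weierstrassP :=
  fun l hl z => L.weierstrassP_add_coe z ⟨l, hl⟩

lemma latticePeriodic_derivWeierstrassP : LatticePeriodic L L.derivWeierstrassP :=
  fun l hl z => L.derivWeierstrassP_add_coe z ⟨l, hl⟩

variable {L}

lemma analyticAt_weierstrassP {z : ℂ} (hz : z ∉ L.lattice) : AnalyticAt ℂ L.weierstrassP z :=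
  L.analyticOnNhd_weierstrassP z hz

lemma analyticAt_derivWeierstrassP {z : ℂ} (hz : z ∉ L.lattice) :
    AnalyticAt ℂ L.derivWeierstrassP z :=
  L.analyticOnNhd_derivWeierstrassP z hz

lemma order_derivWeierstrassP {z : ℂ} (hz : z ∈ L.lattice) :
    meromorphicOrderAt L.derivWeierstrassP z = ((-3 : ℤ) : WithTop ℤ) := by
  rw [← L.deriv_weierstrassP]
  refine meromorphicOrderAt_deriv (n := -3) (by norm_num) ?_
  rw [L.order_weierstrassP z hz]
  rfl

lemma meromorphic_weierstrassP_sub (c : ℂ) : Meromorphic fun z => L.weierstrassP z - c :=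
  fun z => (L.meromorphic_weierstrassP z).sub (MeromorphicAt.const c z)

lemma latticePeriodic_weierstrassP_sub (c : ℂ) :
    LatticePeriodic L fun z => L.weierstrassP z - c :=
  (latticePeriodic_weierstrassP L).sub (.const c)

lemma order_weierstrassP_sub {z : ℂ} (hz : z ∈ L.lattice) (c : ℂ) :
    meromorphicOrderAt (fun z => L.weierstrassP z - c) z = ((-2 : ℤ) : WithTop ℤ) := by
  have h := L.order_weierstrassP z hz
  have h2 : meromorphicOrderAt L.weierstrassP z < meromorphicOrderAt (fun _ : ℂ => -c) z := by
    rw [h]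
    exact lt_of_lt_of_le (by decide) (le_meromorphicOrderAt_const (-c) z)
  have h3 := meromorphicOrderAt_add_eq_left_of_lt (MeromorphicAt.const (-c) z) h2
  rw [h] at h3
  have e : (L.weierstrassP + fun _ => -c) = fun z => L.weierstrassP z - c := by
    ext z; simp [sub_eq_add_neg]
  rw [← e, h3]
  rfl

lemma neg_two_le_order_weierstrassP (z : ℂ) :
    ((-2 : ℤ) : WithTop ℤ) ≤ meromorphicOrderAt L.weierstrassP z := by
  by_cases hz : z ∈ L.lattice
  · rw [L.order_weierstrassP z hz]; exact le_rfl
  · exact le_trans (by decide) (analyticAt_weierstrassP hz).meromorphicOrderAt_nonneg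

lemma derivWeierstrassP_const_sub {l : ℂ} (hl : l ∈ L.lattice) (z : ℂ) :
    L.derivWeierstrassP (l - z) = -L.derivWeierstrassP z := by
  rw [← L.derivWeierstrassP_neg, ← latticePeriodic_derivWeierstrassP L l hl (-z)]
  congr 1; ring

lemma one_le_order_derivWeierstrassP {z : ℂ} (hz : z ∉ L.lattice) (h2 : 2 * z ∈ L.lattice) :
    1 ≤ meromorphicOrderAt L.derivWeierstrassP z :=
  meromorphicOrderAt_pos_of_odd (L.meromorphic_derivWeierstrassP z)
    (analyticAt_derivWeierstrassP hz).meromorphicOrderAt_nonneg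
    fun w => derivWeierstrassP_const_sub h2 w

/-- The points of order two modulo the lattice. -/
lemma half_period_cases {z : ℂ} (h2 : 2 * z ∈ L.lattice) (hz : z ∉ L.lattice) :
    z + L.ω₁ / 2 ∈ L.lattice ∨ z + L.ω₂ / 2 ∈ L.lattice ∨
      z + (L.ω₁ / 2 + L.ω₂ / 2) ∈ L.lattice := by
  obtain ⟨m, n, h⟩ := PeriodPair.mem_lattice.1 h2
  have hz' : z = (m * L.ω₁ + n * L.ω₂) / 2 := by rw [h]; ring
  -- Modulo the lattice, `z` depends only on the parities of `m` and `n`.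
  obtain ⟨k, rfl | rfl⟩ := Int.even_or_odd' m <;> obtain ⟨j, rfl | rfl⟩ := Int.even_or_odd' n
  · refine absurd (PeriodPair.mem_lattice.2 ⟨k, j, ?_⟩) hz
    rw [hz']; push_cast; ring
  · refine Or.inr (Or.inl (PeriodPair.mem_lattice.2 ⟨k, j + 1, ?_⟩))
    rw [hz']; push_cast; ring
  · refine Or.inl (PeriodPair.mem_lattice.2 ⟨k + 1, j, ?_⟩)
    rw [hz']; push_cast; ring
  · refine Or.inr (Or.inr (PeriodPair.mem_lattice.2 ⟨k + 1, j + 1, ?_⟩))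
    rw [hz']; push_cast; ring

lemma two_mul_half_ω₁_mem : 2 * (L.ω₁ / 2) ∈ L.lattice := by
  rw [mul_div_cancel₀ _ two_ne_zero]; exact L.ω₁_mem_lattice

lemma two_mul_half_ω₂_mem : 2 * (L.ω₂ / 2) ∈ L.lattice := by
  rw [mul_div_cancel₀ _ two_ne_zero]; exact L.ω₂_mem_lattice

lemma half_ω₁_add_half_ω₂_notMem : L.ω₁ / 2 + L.ω₂ / 2 ∉ L.lattice := by
  have := L.mul_ω₁_add_mul_ω₂_mem_lattice (α := 1 / 2) (β := 1 / 2)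
  rw [show L.ω₁ / 2 + L.ω₂ / 2 = ((1 / 2 : ℚ) : ℂ) * L.ω₁ + ((1 / 2 : ℚ) : ℂ) * L.ω₂ by
    push_cast; ring, this]
  rintro ⟨h, -⟩
  norm_num at h

/-! ### Zeros of the derivative of ℘ -/

/-- The sum of the orders of `℘'` over a coset of the group of points of order two. -/
lemma sum_order_derivWeierstrassP (z : ℂ) :
    meromorphicOrderAt L.derivWeierstrassP z
      + meromorphicOrderAt L.derivWeierstrassP (z + L.ω₁ / 2)
      + (meromorphicOrderAt L.derivWeierstrassP (z + L.ω₂ / 2)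
      + meromorphicOrderAt L.derivWeierstrassP (z + (L.ω₁ / 2 + L.ω₂ / 2))) = 0 := by
  set a := L.ω₁ / 2 with ha
  set b := L.ω₂ / 2 with hb
  have ha2 : 2 * a ∈ L.lattice := two_mul_half_ω₁_mem
  have hb2 : 2 * b ∈ L.lattice := two_mul_half_ω₂_mem
  have haL : a ∉ L.lattice := L.ω₁_div_two_notMem_lattice
  have hbL : b ∉ L.lattice := L.ω₂_div_two_notMem_lattice
  have hcL : a + b ∉ L.lattice := half_ω₁_add_half_ω₂_notMem
  have hc2 : 2 * (a + b) ∈ L.lattice := by rw [mul_add]; exact add_mem ha2 hb2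
  set D := L.derivWeierstrassP with hD
  have hDm : Meromorphic D := L.meromorphic_derivWeierstrassP
  have hDp : LatticePeriodic L D := latticePeriodic_derivWeierstrassP L
  -- At a lattice point the triple pole of one factor meets zeros of the three others. `Q` is
  -- invariant under `a` and `b`, so this covers every coset containing a pole, and `Q` is a nonzero
  -- constant.
  set Q : ℂ → ℂ := fun z => (D z * D (z + a)) * (D (z + b) * D (z + (a + b))) with hQ
  have m1 := meromorphic_comp_add hDm a
  have m2 := meromorphic_comp_add hDm b
  have m3 := meromorphic_comp_add hDm (a + b)
  have hQm : Meromorphic Q := fun z => ((hDm z).mul (m1 z)).mul ((m2 z).mul (m3 z))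
  have hQp : LatticePeriodic L Q :=
    (hDp.mul (hDp.comp_add a)).mul ((hDp.comp_add b).mul (hDp.comp_add (a + b)))
  have hord : ∀ z, meromorphicOrderAt Q z = meromorphicOrderAt D z
      + meromorphicOrderAt D (z + a) + (meromorphicOrderAt D (z + b)
      + meromorphicOrderAt D (z + (a + b))) := fun z => by
    have h1 := fun_meromorphicOrderAt_mul (hDm z) (m1 z)
    have h2 := fun_meromorphicOrderAt_mul (m2 z) (m3 z)
    have h3 := fun_meromorphicOrderAt_mul ((hDm z).fun_mul (m1 z)) ((m2 z).fun_mul (m3 z))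
    rw [hQ, h3, h1, h2, meromorphicOrderAt_comp_add, meromorphicOrderAt_comp_add,
      meromorphicOrderAt_comp_add]
  have key : ∀ z ∈ L.lattice, ∀ w, w ∉ L.lattice → 2 * w ∈ L.lattice →
      1 ≤ meromorphicOrderAt D (z + w) := fun z hz w hw hw2 => by
    rw [add_comm, hDp.order_eq hz]
    exact one_le_order_derivWeierstrassP hw hw2
  have hlat : ∀ z ∈ L.lattice, 0 ≤ meromorphicOrderAt Q z := fun z hz => by
    rw [hord]
    calc (0 : WithTop ℤ) = ((-3 : ℤ) : WithTop ℤ) + 1 + (1 + 1) := rfl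
      _ ≤ _ := add_le_add (add_le_add (order_derivWeierstrassP hz).ge (key z hz a haL ha2))
          (add_le_add (key z hz b hbL hb2) (key z hz _ hcL hc2))
  have hsa : ∀ z, Q (z + a) = Q z := fun z => by
    have e1 : D (z + a + a) = D z := by rw [← hDp _ ha2 z]; congr 1; ring
    have e2 : D (z + a + b) = D (z + (a + b)) := by congr 1; ring
    have e3 : D (z + a + (a + b)) = D (z + b) := by rw [← hDp _ ha2 (z + b)]; congr 1; ring
    simp only [hQ, e1, e2, e3]; ring
  have hsb : ∀ z, Q (z + b) = Q z := fun z => by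
    have e1 : D (z + b + b) = D z := by rw [← hDp _ hb2 z]; congr 1; ring
    have e2 : D (z + b + a) = D (z + (a + b)) := by congr 1; ring
    have e3 : D (z + b + (a + b)) = D (z + a) := by rw [← hDp _ hb2 (z + a)]; congr 1; ring
    simp only [hQ, e1, e2, e3]; ring
  have hoa : ∀ z, meromorphicOrderAt Q (z + a) = meromorphicOrderAt Q z := fun z => by
    rw [← meromorphicOrderAt_comp_add]; simp only [hsa]
  have hob : ∀ z, meromorphicOrderAt Q (z + b) = meromorphicOrderAt Q z := fun z => by
    rw [← meromorphicOrderAt_comp_add]; simp only [hsb]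
  have hnn : ∀ w, w ∉ L.lattice → 0 ≤ meromorphicOrderAt D w :=
    fun w hw => (analyticAt_derivWeierstrassP hw).meromorphicOrderAt_nonneg
  have hQ0 : ∀ z, 0 ≤ meromorphicOrderAt Q z := by
    intro z
    by_cases h0 : z ∈ L.lattice
    · exact hlat z h0
    by_cases h1 : z + a ∈ L.lattice
    · rw [← hoa]; exact hlat _ h1
    by_cases h2 : z + b ∈ L.lattice
    · rw [← hob]; exact hlat _ h2
    by_cases h3 : z + (a + b) ∈ L.lattice
    · rw [← hoa, ← hob, add_assoc]; exact hlat _ h3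
    rw [hord]
    exact add_nonneg (add_nonneg (hnn _ h0) (hnn _ h1)) (add_nonneg (hnn _ h2) (hnn _ h3))
  obtain ⟨c, hc⟩ := exists_const_of_order_nonneg hQm hQp hQ0
  have hDtop : ∀ w, meromorphicOrderAt D w ≠ ⊤ := fun w hw => by
    have := meromorphicOrderAt_eq_top_of_exists hDm hw 0
    rw [order_derivWeierstrassP (zero_mem _)] at this
    exact absurd this (by decide)
  have hc0 : c ≠ 0 := const_ne_zero_of_order_ne_top (hc z) (by
    rw [hord]
    simp only [ne_eq, WithTop.add_eq_top, hDtop, or_self, not_false_eq_true])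
  rw [← hord]
  exact meromorphicOrderAt_eq_zero_of_const (hc z) hc0

lemma order_derivWeierstrassP_ne_top (z : ℂ) : meromorphicOrderAt L.derivWeierstrassP z ≠ ⊤ := by
  intro h
  have := meromorphicOrderAt_eq_top_of_exists L.meromorphic_derivWeierstrassP h 0
  rw [order_derivWeierstrassP (zero_mem _)] at this
  exact absurd this (by decide)

/-- A triple pole and three zeros of order at least one have total order 0, so each zero is simple.
-/
lemma order_derivWeierstrassP_of_half {z : ℂ} (hz : z ∉ L.lattice) (h2 : 2 * z ∈ L.lattice) :
    meromorphicOrderAt L.derivWeierstrassP z = 1 := by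
  have hs := sum_order_derivWeierstrassP (L := L) 0
  have h0 := order_derivWeierstrassP (L := L) (zero_mem _)
  have ha := one_le_order_derivWeierstrassP L.ω₁_div_two_notMem_lattice two_mul_half_ω₁_mem
  have hb := one_le_order_derivWeierstrassP L.ω₂_div_two_notMem_lattice two_mul_half_ω₂_mem
  have hc := one_le_order_derivWeierstrassP (L := L) half_ω₁_add_half_ω₂_notMem
    (by rw [mul_add]; exact add_mem two_mul_half_ω₁_mem two_mul_half_ω₂_mem)
  simp only [zero_add] at hs
  obtain ⟨x, hx⟩ := WithTop.ne_top_iff_exists.1 (order_derivWeierstrassP_ne_top (L := L) (L.ω₁ / 2))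
  obtain ⟨y, hy⟩ := WithTop.ne_top_iff_exists.1 (order_derivWeierstrassP_ne_top (L := L) (L.ω₂ / 2))
  obtain ⟨w, hw⟩ := WithTop.ne_top_iff_exists.1
    (order_derivWeierstrassP_ne_top (L := L) (L.ω₁ / 2 + L.ω₂ / 2))
  rw [h0, ← hx, ← hy, ← hw] at hs
  rw [← hx] at ha
  rw [← hy] at hb
  rw [← hw] at hc
  have ha' : (1 : ℤ) ≤ x := WithTop.coe_le_coe.1 ha
  have hb' : (1 : ℤ) ≤ y := WithTop.coe_le_coe.1 hb
  have hc' : (1 : ℤ) ≤ w := WithTop.coe_le_coe.1 hc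
  have hs' : (-3 : ℤ) + x + (y + w) = 0 := WithTop.coe_inj.1 hs
  obtain ⟨rfl, rfl, rfl⟩ : x = 1 ∧ y = 1 ∧ w = 1 := by omega
  have hev : ∀ u, z + u ∈ L.lattice →
      meromorphicOrderAt L.derivWeierstrassP z = meromorphicOrderAt L.derivWeierstrassP u := by
    intro u hu
    have h1 := (latticePeriodic_derivWeierstrassP L).order_eq (neg_mem hu) z
    rw [← h1, show z + -(z + u) = -u by ring, ← meromorphicOrderAt_comp_neg]
    simp only [PeriodPair.derivWeierstrassP_neg]
    exact meromorphicOrderAt_fun_neg.symm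
  rcases half_period_cases h2 hz with h | h | h
  · rw [hev _ h, ← hx]; rfl
  · rw [hev _ h, ← hy]; rfl
  · rw [hev _ h, ← hw]; rfl

/-- None of the four points of the coset is a pole, so four nonnegative orders add up to 0. -/
lemma order_derivWeierstrassP_of_not_half {z : ℂ} (h2 : 2 * z ∉ L.lattice) :
    meromorphicOrderAt L.derivWeierstrassP z = 0 := by
  have hs := sum_order_derivWeierstrassP (L := L) z
  have key : ∀ w, 2 * w ∈ L.lattice →
      0 ≤ meromorphicOrderAt L.derivWeierstrassP (z + w) := fun w hw => by
    refine (analyticAt_derivWeierstrassP fun h => h2 ?_).meromorphicOrderAt_nonneg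
    convert sub_mem (add_mem h h) hw using 1
    ring
  have h0 := key 0 (by simp)
  have ha := key _ two_mul_half_ω₁_mem
  have hb := key _ two_mul_half_ω₂_mem
  have hc := key (L.ω₁ / 2 + L.ω₂ / 2)
    (by rw [mul_add]; exact add_mem two_mul_half_ω₁_mem two_mul_half_ω₂_mem)
  rw [add_zero] at h0
  refine le_antisymm ?_ h0
  rw [← hs, add_assoc]
  exact le_add_of_nonneg_right (add_nonneg ha (add_nonneg hb hc))

lemma derivWeierstrassP_ne_zero {z : ℂ} (h2 : 2 * z ∉ L.lattice) : L.derivWeierstrassP z ≠ 0 := by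
  have hz : z ∉ L.lattice := fun h => h2 (by rw [two_mul]; exact add_mem h h)
  have h := order_derivWeierstrassP_of_not_half h2
  have han := analyticAt_derivWeierstrassP hz
  rw [han.meromorphicOrderAt_eq] at h
  intro h0
  have h1 := analyticOrderAt_ne_zero.2 ⟨han, h0⟩
  apply h1
  cases e : analyticOrderAt L.derivWeierstrassP z with
  | top => rw [e] at h; exact absurd h (by simp)
  | coe n =>
    rw [e] at h
    simp only [ENat.map_natCast] at h
    have : n = 0 := by exact_mod_cast h
    rw [this]; rfl

/-- `℘` takes its value at a point which is not of order two simply. -/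
lemma analyticOrderAt_weierstrassP_sub_of_not_half {z : ℂ} (h2 : 2 * z ∉ L.lattice) :
    analyticOrderAt (fun w => L.weierstrassP w - L.weierstrassP z) z = 1 := by
  have hz : z ∉ L.lattice := fun h => h2 (by rw [two_mul]; exact add_mem h h)
  refine (analyticAt_weierstrassP hz).analyticOrderAt_sub_eq_one_of_deriv_ne_zero ?_
  rw [L.deriv_weierstrassP]
  exact derivWeierstrassP_ne_zero h2

/-- `℘` takes its value at a point of order two doubly. -/
lemma analyticOrderAt_weierstrassP_sub_of_half {z : ℂ} (hz : z ∉ L.lattice)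
    (h2 : 2 * z ∈ L.lattice) :
    analyticOrderAt (fun w => L.weierstrassP w - L.weierstrassP z) z = 2 := by
  rw [← (analyticAt_weierstrassP hz).analyticOrderAt_deriv_add_one, L.deriv_weierstrassP]
  have h := order_derivWeierstrassP_of_half hz h2
  rw [(analyticAt_derivWeierstrassP hz).meromorphicOrderAt_eq] at h
  cases e : analyticOrderAt L.derivWeierstrassP z with
  | top => rw [e] at h; exact absurd h (by decide)
  | coe n =>
    rw [e] at h
    simp only [ENat.map_natCast] at h
    have : n = 1 := by exact_mod_cast h
    rw [this]; rfl

lemma weierstrassP_sub_analyticAt {z : ℂ} (hz : z ∉ L.lattice) (c : ℂ) :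
    AnalyticAt ℂ (fun w => L.weierstrassP w - c) z :=
  (analyticAt_weierstrassP hz).sub analyticAt_const

lemma order_weierstrassP_sub_of_half {z : ℂ} (hz : z ∉ L.lattice) (h2 : 2 * z ∈ L.lattice) :
    meromorphicOrderAt (fun w => L.weierstrassP w - L.weierstrassP z) z = 2 := by
  rw [(weierstrassP_sub_analyticAt hz _).meromorphicOrderAt_eq,
    analyticOrderAt_weierstrassP_sub_of_half hz h2]
  rfl

lemma order_weierstrassP_sub_of_not_half {z : ℂ} (h2 : 2 * z ∉ L.lattice) :
    meromorphicOrderAt (fun w => L.weierstrassP w - L.weierstrassP z) z = 1 := by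
  have hz : z ∉ L.lattice := fun h => h2 (by rw [two_mul]; exact add_mem h h)
  rw [(weierstrassP_sub_analyticAt hz _).meromorphicOrderAt_eq,
    analyticOrderAt_weierstrassP_sub_of_not_half h2]
  rfl

lemma order_weierstrassP_sub_ne_top (c z : ℂ) :
    meromorphicOrderAt (fun w => L.weierstrassP w - c) z ≠ ⊤ := by
  intro h
  have := meromorphicOrderAt_eq_top_of_exists (meromorphic_weierstrassP_sub c) h 0
  rw [order_weierstrassP_sub (zero_mem _)] at this
  exact absurd this (by decide)

/-! ### Half-period translations, fibres and range of ℘ -/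

/-- Translation by a point of order two acts on `℘` by an involutive Möbius transformation. -/
lemma exists_weierstrassP_half_translate {a : ℂ} (ha : a ∉ L.lattice) (h2 : 2 * a ∈ L.lattice) :
    ∃ K : ℂ, K ≠ 0 ∧ ∀ z, z ∉ L.lattice → z + a ∉ L.lattice →
      (L.weierstrassP z - L.weierstrassP a) * (L.weierstrassP (z + a) - L.weierstrassP a) = K := by
  -- `p` has double poles on the lattice and a double zero at `a`, so in p(z) p(z + a) every pole of
  -- one factor is cancelled by the other.
  set p : ℂ → ℂ := fun z => L.weierstrassP z - L.weierstrassP a with hp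
  have hm : Meromorphic p := meromorphic_weierstrassP_sub _
  have hm2 := meromorphic_comp_add hm a
  have hper : LatticePeriodic L p := latticePeriodic_weierstrassP_sub _
  have hord : ∀ z, meromorphicOrderAt (fun z => p z * p (z + a)) z =
      meromorphicOrderAt p z + meromorphicOrderAt p (z + a) := fun z => by
    rw [fun_meromorphicOrderAt_mul (hm z) (hm2 z), meromorphicOrderAt_comp_add]
  have hpa : meromorphicOrderAt p a = 2 := order_weierstrassP_sub_of_half ha h2
  have h0 : ∀ z, 0 ≤ meromorphicOrderAt (fun z => p z * p (z + a)) z := by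
    intro z
    rw [hord]
    by_cases hz : z ∈ L.lattice
    · rw [add_comm z a, hper.order_eq hz, hpa, order_weierstrassP_sub hz]; exact le_rfl
    by_cases hza : z + a ∈ L.lattice
    · have : z = a + (z + a - 2 * a) := by ring
      rw [order_weierstrassP_sub hza, this, hper.order_eq (sub_mem hza h2), hpa]; exact le_rfl
    · exact add_nonneg (weierstrassP_sub_analyticAt hz _).meromorphicOrderAt_nonneg
        (weierstrassP_sub_analyticAt hza _).meromorphicOrderAt_nonneg
  obtain ⟨K, hK⟩ := exists_const_of_order_nonneg (fun z => (hm z).fun_mul (hm2 z))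
    (hper.mul (hper.comp_add a)) h0
  refine ⟨K, const_ne_zero_of_order_ne_top (hK 0) ?_, fun z hz hza => ?_⟩
  · rw [hord, ne_eq, WithTop.add_eq_top, not_or]
    exact ⟨order_weierstrassP_sub_ne_top _ _, order_weierstrassP_sub_ne_top _ _⟩
  · refine eq_of_eventuallyEq_const (f := fun z => p z * p (z + a)) ?_ (hK z)
    have c1 := (weierstrassP_sub_analyticAt hz (L.weierstrassP a)).continuousAt
    have c2 : ContinuousAt (fun z => p (z + a)) z :=
      ContinuousAt.comp (f := fun z : ℂ => z + a) (g := p)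
        (weierstrassP_sub_analyticAt hza (L.weierstrassP a)).continuousAt (by fun_prop)
    exact c1.mul c2

/-- Otherwise a product with nonzero constant value `K` would have a vanishing factor. -/
lemma add_mem_of_weierstrassP_eq_half {a z : ℂ} (ha : a ∉ L.lattice) (h2 : 2 * a ∈ L.lattice)
    (hz : z ∉ L.lattice) (h : L.weierstrassP z = L.weierstrassP a) : z + a ∈ L.lattice := by
  by_contra hza
  obtain ⟨K, hK, hKz⟩ := exists_weierstrassP_half_translate ha h2
  apply hK
  rw [← hKz z hz hza, h, sub_self, zero_mul]

/-- `℘` takes the same value only at opposite points. -/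
theorem sub_mem_or_add_mem_of_weierstrassP_eq {a b : ℂ} (ha : a ∉ L.lattice) (hb : b ∉ L.lattice)
    (h : L.weierstrassP b = L.weierstrassP a) : b - a ∈ L.lattice ∨ b + a ∈ L.lattice := by
  by_cases ha2 : 2 * a ∈ L.lattice
  · exact Or.inr (add_mem_of_weierstrassP_eq_half ha ha2 hb h)
  by_cases hb2 : 2 * b ∈ L.lattice
  · right
    rw [add_comm]
    exact add_mem_of_weierstrassP_eq_half hb hb2 ha h.symm
  by_contra hcon
  obtain ⟨hsub, hadd⟩ := not_or.1 hcon
  set p := L.weierstrassP with hpdef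
  have hpm : Meromorphic p := L.meromorphic_weierstrassP
  have hpp : LatticePeriodic L p := latticePeriodic_weierstrassP L
  have mA := meromorphic_comp_add hpm a
  have mB := meromorphic_comp_add hpm (-a)
  -- The model is the classical identity (℘(z + a) - ℘(z - a)) (℘ z - ℘ a)² = -℘'(z) ℘'(a). Only
  -- constancy and nonvanishing of the quotient by ℘'(z) are needed: at `b` the squared factor
  -- vanishes, the difference is finite and ℘'(b) ≠ 0, which makes the constant 0.
  set H : ℂ → ℂ := fun z => p (z + a) - p (z + -a) with hH
  have hHm : Meromorphic H := fun z => (mA z).sub (mB z)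
  have hHp : LatticePeriodic L H := (hpp.comp_add a).sub (hpp.comp_add (-a))
  have hHodd : ∀ z, H (-z) = -H z := fun z => by
    have e1 : p (-z + a) = p (z + -a) := by
      rw [hpdef, ← L.weierstrassP_neg]; congr 1; ring
    have e2 : p (-z + -a) = p (z + a) := by
      rw [hpdef, ← L.weierstrassP_neg]; congr 1; ring
    simp only [hH, e1, e2]; ring
  set q : ℂ → ℂ := fun z => p z - p a with hq
  have hqm : Meromorphic q := meromorphic_weierstrassP_sub _
  have hqp : LatticePeriodic L q := latticePeriodic_weierstrassP_sub _
  have hqe : ∀ z, q (-z) = q z := fun z => by simp only [hq, hpdef, L.weierstrassP_neg]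
  set E : ℂ → ℂ := fun z => H z * (q z * q z) with hE
  have hEm : Meromorphic E := fun z => (hHm z).mul ((hqm z).mul (hqm z))
  have hEp : LatticePeriodic L E := hHp.mul (hqp.mul hqp)
  have hEodd : ∀ z, E (-z) = -E z := fun z => by
    simp only [hE, hHodd, hqe]; ring
  have hHm2 : ∀ z, ((-2 : ℤ) : WithTop ℤ) ≤ meromorphicOrderAt H z := fun z => by
    refine le_meromorphicOrderAt_sub (mA z) (mB z) ?_ ?_ <;> rw [meromorphicOrderAt_comp_add] <;>
      exact neg_two_le_order_weierstrassP _
  have hH0 : ∀ z, z + a ∉ L.lattice → z - a ∉ L.lattice → 0 ≤ meromorphicOrderAt H z :=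
    fun z h1 h2 => by
      refine le_meromorphicOrderAt_sub (mA z) (mB z) ?_ ?_ <;> rw [meromorphicOrderAt_comp_add]
      · exact (analyticAt_weierstrassP h1).meromorphicOrderAt_nonneg
      · rw [← sub_eq_add_neg]; exact (analyticAt_weierstrassP h2).meromorphicOrderAt_nonneg
  have hq0 : ∀ z, z ∉ L.lattice → 0 ≤ meromorphicOrderAt q z := fun z hz =>
    (weierstrassP_sub_analyticAt hz _).meromorphicOrderAt_nonneg
  have hqa : meromorphicOrderAt q a = 1 := order_weierstrassP_sub_of_not_half ha2
  have hqna : meromorphicOrderAt q (-a) = 1 := by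
    rw [← meromorphicOrderAt_comp_neg]
    simp only [hqe, hqa]
  have hEle : ∀ z {m n : WithTop ℤ}, m ≤ meromorphicOrderAt H z → n ≤ meromorphicOrderAt q z →
      m + (n + n) ≤ meromorphicOrderAt E z := fun z m n hm hn =>
    le_meromorphicOrderAt_mul (hHm z) ((hqm z).fun_mul (hqm z)) hm
      (le_meromorphicOrderAt_mul (hqm z) (hqm z) hn hn)
  have hhalf : ∀ z, 2 * z ∈ L.lattice → z + a ∉ L.lattice ∧ z - a ∉ L.lattice := by
    refine fun z hz2 => ⟨fun h => ha2 ?_, fun h => ha2 ?_⟩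
    · convert sub_mem (add_mem h h) hz2 using 1; ring
    · convert sub_mem hz2 (add_mem h h) using 1; ring
  set D := L.derivWeierstrassP with hD
  have hDm : Meromorphic D := L.meromorphic_derivWeierstrassP
  have hDp : LatticePeriodic L D := latticePeriodic_derivWeierstrassP L
  have hDi : ∀ z, meromorphicOrderAt (fun z => (D z)⁻¹) z = -meromorphicOrderAt D z :=
    fun z => fun_meromorphicOrderAt_inv
  -- On the lattice `H` is odd, and the orders add up to at least 1 - 4 + 3 = 0. At the other half
  -- periods the zero of the odd `E` offsets the simple zero of `D`. At ±a the double zero of q²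
  -- absorbs the pole of `H`.
  have hR0 : ∀ z, 0 ≤ meromorphicOrderAt (fun z => E z * (D z)⁻¹) z := by
    intro z
    rw [fun_meromorphicOrderAt_mul (hEm z) (hDm z).fun_inv, hDi]
    by_cases hz : z ∈ L.lattice
    · have hz2 : 2 * z ∈ L.lattice := by rw [two_mul]; exact add_mem hz hz
      have h1 : 1 ≤ meromorphicOrderAt H z := by
        refine meromorphicOrderAt_pos_of_odd (hHm z) (hH0 z (hhalf z hz2).1 (hhalf z hz2).2)
          fun w => ?_
        rw [← hHodd, ← hHp _ hz2 (-w)]; congr 1; ring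
      have h2 := hEle z h1 (order_weierstrassP_sub hz (p a)).ge
      rw [order_derivWeierstrassP hz]
      exact le_trans le_rfl (add_le_add_left h2 _)
    by_cases hz2 : 2 * z ∈ L.lattice
    · have h1 : 1 ≤ meromorphicOrderAt E z := by
        refine meromorphicOrderAt_pos_of_odd (hEm z) ?_ fun w => ?_
        · simpa using hEle z (hH0 z (hhalf z hz2).1 (hhalf z hz2).2) (hq0 z hz)
        · rw [← hEodd, ← hEp _ hz2 (-w)]; congr 1; ring
      rw [order_derivWeierstrassP_of_half hz hz2]
      exact le_trans le_rfl (add_le_add_left h1 _)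
    · rw [order_derivWeierstrassP_of_not_half hz2, neg_zero, add_zero]
      by_cases h1 : z + a ∈ L.lattice
      · have h2 : meromorphicOrderAt q z = 1 := by
          rw [← hqna, ← hqp.order_eq h1 (-a)]; congr 1; ring
        exact le_trans le_rfl (hEle z (hHm2 z) h2.ge)
      by_cases h2 : z - a ∈ L.lattice
      · have h2 : meromorphicOrderAt q z = 1 := by
          rw [← hqa, ← hqp.order_eq h2 a]; congr 1; ring
        exact le_trans le_rfl (hEle z (hHm2 z) h2.ge)
      · simpa using hEle z (hH0 z h1 h2) (hq0 z hz)
  obtain ⟨c, hc⟩ := exists_const_of_order_nonneg (fun z => (hEm z).fun_mul (hDm z).fun_inv)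
    (hEp.mul hDp.inv) hR0
  -- At `a` the term p(z - a) has a pole and p(z + a) has none, since 2a is not a period.
  have hHa : meromorphicOrderAt H a ≠ ⊤ := by
    intro htop
    have h1 : Tendsto H (𝓝[≠] a) (𝓝 0) :=
      (tendsto_zero_iff_meromorphicOrderAt_pos (hHm a)).2 (by rw [htop]; decide)
    have h2 : ContinuousAt (fun z => p (z + a)) a :=
      ContinuousAt.comp (f := fun z : ℂ => z + a) (g := p)
        (analyticAt_weierstrassP (by rwa [← two_mul])).continuousAt (by fun_prop)
    have h3 := (h2.tendsto.mono_left (nhdsWithin_le_nhds (s := {a}ᶜ))).sub h1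
    have e : (fun z => p (z + a) - H z) = fun z => p (z + -a) := by
      ext z; simp only [hH]; ring
    rw [e] at h3
    have h4 := (tendsto_nhds_iff_meromorphicOrderAt_nonneg (mB a)).1 ⟨_, h3⟩
    rw [meromorphicOrderAt_comp_add, add_neg_cancel, L.order_weierstrassP 0 (zero_mem _)] at h4
    exact absurd h4 (by decide)
  have hc0 : c ≠ 0 := by
    refine const_ne_zero_of_order_ne_top (hc a) ?_
    rw [fun_meromorphicOrderAt_mul (hEm a) (hDm a).fun_inv, hDi,
      order_derivWeierstrassP_of_not_half ha2, neg_zero, add_zero, hE,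
      fun_meromorphicOrderAt_mul (hHm a) ((hqm a).fun_mul (hqm a)),
      fun_meromorphicOrderAt_mul (hqm a) (hqm a), hqa]
    intro h
    rcases WithTop.add_eq_top.1 h with h | h
    · exact hHa h
    · exact absurd h (by decide)
  have hb' := hc b
  have hcont : ContinuousAt (fun z => E z * (D z)⁻¹) b := by
    have c1 : ContinuousAt (fun z => p (z + a)) b :=
      ContinuousAt.comp (f := fun z : ℂ => z + a) (g := p)
        (analyticAt_weierstrassP hadd).continuousAt (by fun_prop)
    have c2 : ContinuousAt (fun z => p (z + -a)) b :=
      ContinuousAt.comp (f := fun z : ℂ => z + -a) (g := p)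
        (analyticAt_weierstrassP (by rwa [← sub_eq_add_neg])).continuousAt (by fun_prop)
    have c3 := (weierstrassP_sub_analyticAt hb (p a)).continuousAt
    have c4 := (analyticAt_derivWeierstrassP hb).continuousAt
    exact ((c1.sub c2).mul (c3.mul c3)).mul (c4.inv₀ (derivWeierstrassP_ne_zero hb2))
  have := eq_of_eventuallyEq_const (f := fun z => E z * (D z)⁻¹) hcont hb'
  apply hc0
  rw [← this]
  simp [hE, hq, h]

/-- `℘` takes every finite value. -/
theorem exists_weierstrassP_eq (c : ℂ) : ∃ z, z ∉ L.lattice ∧ L.weierstrassP z = c := by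
  -- If `c` were omitted, 1/(℘ - c) would have no poles and be constant, yet it has a double zero on
  -- the lattice.
  by_contra hcon
  have hne : ∀ z, z ∉ L.lattice → L.weierstrassP z - c ≠ 0 := fun z hz h =>
    hcon ⟨z, hz, sub_eq_zero.1 h⟩
  have hm : Meromorphic fun z => L.weierstrassP z - c := meromorphic_weierstrassP_sub c
  have hi : ∀ z, meromorphicOrderAt (fun z => (L.weierstrassP z - c)⁻¹) z =
      -meromorphicOrderAt (fun z => L.weierstrassP z - c) z := fun z => fun_meromorphicOrderAt_inv
  have h0 : ∀ z, 0 ≤ meromorphicOrderAt (fun z => (L.weierstrassP z - c)⁻¹) z := by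
    intro z
    by_cases hz : z ∈ L.lattice
    · rw [hi, order_weierstrassP_sub hz]; decide
    · exact ((weierstrassP_sub_analyticAt hz c).inv (hne z hz)).meromorphicOrderAt_nonneg
  obtain ⟨k, hk⟩ := exists_const_of_order_nonneg (fun z => (hm z).fun_inv)
    (latticePeriodic_weierstrassP_sub c).inv h0
  have h1 := hi 0
  rw [order_weierstrassP_sub (zero_mem _)] at h1
  have hk0 : k ≠ 0 := const_ne_zero_of_order_ne_top (hk 0) (by rw [h1]; decide)
  rw [meromorphicOrderAt_eq_zero_of_const (hk 0) hk0] at h1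
  exact absurd h1 (by decide)

end Weierstrass

end EllipticModuli

noncomputable section
open Filter Topology

namespace EllipticModuli

/-! ### Homogeneous coordinates on the sphere -/

/-- The point of `S²` with homogeneous coordinates `(x : y)`. -/
def ofHomog (v : ℂ × ℂ) : OnePoint ℂ :=
  open Classical in if v.2 = 0 then OnePoint.infty else ((v.1 / v.2 : ℂ) : OnePoint ℂ)

lemma ofHomog_of_eq {v : ℂ × ℂ} (h : v.2 = 0) : ofHomog v = OnePoint.infty := if_pos h

lemma ofHomog_of_ne {v : ℂ × ℂ} (h : v.2 ≠ 0) : ofHomog v = ((v.1 / v.2 : ℂ) : OnePoint ℂ) :=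
  if_neg h

lemma ofHomog_smul {c : ℂ} (hc : c ≠ 0) (v : ℂ × ℂ) : ofHomog (c • v) = ofHomog v := by
  by_cases h : v.2 = 0
  · rw [ofHomog_of_eq h, ofHomog_of_eq (by simp [h])]
  · rw [ofHomog_of_ne h, ofHomog_of_ne (by simp [h, hc])]
    simp [mul_div_mul_left _ _ hc]

/-- The origin represents no point of the sphere; `ofHomog` sends it to ∞ by default, hence the
hypothesis. -/
lemma continuousAt_ofHomog {v : ℂ × ℂ} (hv : v ≠ 0) : ContinuousAt ofHomog v := by
  by_cases h : v.2 = 0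
  · have hx : v.1 ≠ 0 := fun hx => hv (Prod.ext hx h)
    rw [ContinuousAt, ofHomog_of_eq h, OnePoint.hasBasis_nhds_infty.tendsto_right_iff]
    rintro K ⟨-, hK⟩
    obtain ⟨R, hR⟩ := hK.isBounded.exists_norm_le
    -- Under this inequality the ratio of the coordinates has norm above `R`, so it lies outside
    -- `K`.
    have h1 : ∀ᶠ w : ℂ × ℂ in 𝓝 v, R * ‖w.2‖ < ‖w.1‖ := by
      apply ContinuousAt.eventually_lt (by fun_prop) (by fun_prop)
      simp [h, hx]
    filter_upwards [h1] with w hw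
    by_cases h2 : w.2 = 0
    · rw [ofHomog_of_eq h2]; exact Or.inr rfl
    · rw [ofHomog_of_ne h2]
      refine Or.inl ⟨_, fun hmem => ?_, rfl⟩
      have := hR _ hmem
      rw [norm_div, div_le_iff₀ (norm_pos_iff.2 h2)] at this
      linarith
  · have h1 : ∀ᶠ w : ℂ × ℂ in 𝓝 v, ((w.1 / w.2 : ℂ) : OnePoint ℂ) = ofHomog w := by
      have : ∀ᶠ w : ℂ × ℂ in 𝓝 v, w.2 ≠ 0 := continuous_snd.continuousAt.eventually_ne h
      filter_upwards [this] with w hw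
      rw [ofHomog_of_ne hw]
    refine ContinuousAt.congr ?_ h1
    refine OnePoint.continuous_coe.continuousAt.comp' ?_
    exact continuous_fst.continuousAt.div continuous_snd.continuousAt h

/-- Local continuous lifts to homogeneous coordinates. -/
lemma exists_homog_lift (w₀ : OnePoint ℂ) : ∃ σ : OnePoint ℂ → ℂ × ℂ,
    ContinuousAt σ w₀ ∧ σ w₀ ≠ 0 ∧ ofHomog (σ w₀) = w₀ ∧ ∀ᶠ w in 𝓝 w₀, ofHomog (σ w) = w := by
  induction w₀ using OnePoint.rec with
  | infty =>
    refine ⟨fun w => (1, w.elim 0 fun u : ℂ => u⁻¹), ?_, ?_, ?_, ?_⟩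
    · refine continuousAt_const.prodMk ?_
      rw [OnePoint.continuousAt_infty', OnePoint.elim_infty]
      have h := tendsto_inv₀_cobounded (α := ℂ)
      rw [Metric.cobounded_eq_cocompact] at h
      rw [coclosedCompact_eq_cocompact]
      exact h
    · simp
    · exact ofHomog_of_eq rfl
    -- With 0⁻¹ = 0 the lift of 0 would be (1 : 0), the wrong point, so 0 is kept out of the
    -- neighbourhood.
    · have h0 : ∀ᶠ w in 𝓝 (OnePoint.infty : OnePoint ℂ), w ≠ ((0 : ℂ) : OnePoint ℂ) :=
        isOpen_ne.mem_nhds (OnePoint.infty_ne_coe 0)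
      filter_upwards [h0] with w hw
      induction w using OnePoint.rec with
      | infty => exact ofHomog_of_eq rfl
      | coe u =>
        have hu : u ≠ 0 := fun h => hw (by rw [h])
        rw [ofHomog_of_ne (by simpa using hu)]
        simp
  | coe a =>
    have hc : ∀ u : ℂ, ofHomog (u, 1) = u := fun u => by
      rw [ofHomog_of_ne one_ne_zero, div_one]
    refine ⟨fun w => (w.elim 0 id, 1), ?_, ?_, hc a, ?_⟩
    · refine ContinuousAt.prodMk ?_ continuousAt_const
      rw [OnePoint.continuousAt_coe]
      exact continuousAt_id
    · simp
    · have h0 : ∀ᶠ w in 𝓝 (a : OnePoint ℂ), w ≠ OnePoint.infty :=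
        isOpen_ne.mem_nhds (OnePoint.coe_ne_infty a)
      filter_upwards [h0] with w hw
      induction w using OnePoint.rec with
      | infty => exact absurd rfl hw
      | coe u => exact hc u

/-- The linear action on homogeneous coordinates. -/
def linAct (A : Matrix (Fin 2) (Fin 2) ℂ) (v : ℂ × ℂ) : ℂ × ℂ :=
  (A 0 0 * v.1 + A 0 1 * v.2, A 1 0 * v.1 + A 1 1 * v.2)

lemma continuous_linAct :
    Continuous fun p : Matrix (Fin 2) (Fin 2) ℂ × (ℂ × ℂ) => linAct p.1 p.2 := by
  unfold linAct
  fun_prop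

lemma det_SL2 (A : SL2) : A.1 0 0 * A.1 1 1 - A.1 0 1 * A.1 1 0 = 1 := by
  rw [← Matrix.det_fin_two]; exact A.2

lemma linAct_eq_zero {A : Matrix (Fin 2) (Fin 2) ℂ} (hA : A.det ≠ 0) {v : ℂ × ℂ}
    (h : linAct A v = 0) : v = 0 := by
  have h1 : A 0 0 * v.1 + A 0 1 * v.2 = 0 := congrArg Prod.fst h
  have h2 : A 1 0 * v.1 + A 1 1 * v.2 = 0 := congrArg Prod.snd h
  rw [Matrix.det_fin_two] at hA
  refine Prod.ext ?_ ?_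
  · refine (mul_eq_zero.1 (?_ : _ * v.1 = 0)).resolve_left hA
    linear_combination A 1 1 * h1 - A 0 1 * h2
  · refine (mul_eq_zero.1 (?_ : _ * v.2 = 0)).resolve_left hA
    linear_combination A 0 0 * h2 - A 1 0 * h1

lemma moebiusSL_ofHomog (A : SL2) {v : ℂ × ℂ} (hv : v ≠ 0) :
    moebiusSL A (ofHomog v) = ofHomog (linAct A.1 v) := by
  by_cases h : v.2 = 0
  · have hx : v.1 ≠ 0 := fun hx => hv (Prod.ext hx h)
    rw [ofHomog_of_eq h, moebiusSL_infty]
    split_ifs with h1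
    · rw [ofHomog_of_eq (by simp [linAct, h, h1])]
    · rw [ofHomog_of_ne (by simp [linAct, h, h1, hx])]
      simp [linAct, h, mul_div_mul_right _ _ hx]
  · have e : A.1 1 0 * (v.1 / v.2) + A.1 1 1 = (linAct A.1 v).2 / v.2 := by
      simp only [linAct]; field_simp
    rw [ofHomog_of_ne h, moebiusSL_coe, e]
    split_ifs with h1
    · rw [ofHomog_of_eq (by simpa [h] using h1)]
    · have h2 : (linAct A.1 v).2 ≠ 0 := fun h2 => h1 (by simp [h2])
      rw [ofHomog_of_ne h2]
      congr 1
      rw [div_eq_div_iff (div_ne_zero h2 h) h2]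
      simp only [linAct]
      field_simp

/-! ### Continuity of the action and of the stereographic projection -/

/-- In homogeneous coordinates the action is polynomial and never reaches the origin, so no case
distinction at ∞ arises. -/
lemma continuous_moebiusSL :
    Continuous fun p : SL2 × OnePoint ℂ => moebiusSL p.1 p.2 := by
  rw [continuous_iff_continuousAt]
  rintro ⟨A, w⟩
  obtain ⟨σ, hσ, hσ0, hσw, hev⟩ := exists_homog_lift w
  have h1 : ContinuousAt (fun p : SL2 × OnePoint ℂ => linAct p.1.1 (σ p.2)) (A, w) := by
    refine continuous_linAct.continuousAt.comp' (ContinuousAt.prodMk ?_ ?_)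
    · exact (continuous_subtype_val.comp continuous_fst).continuousAt
    · exact ContinuousAt.comp (g := σ) (f := Prod.snd) hσ continuous_snd.continuousAt
  have hne : linAct A.1 (σ w) ≠ 0 := fun h => hσ0 (linAct_eq_zero (by rw [A.2]; simp) h)
  have h2 : ContinuousAt (fun p : SL2 × OnePoint ℂ => ofHomog (linAct p.1.1 (σ p.2))) (A, w) :=
    ContinuousAt.comp (g := ofHomog) (f := fun p : SL2 × OnePoint ℂ => linAct p.1.1 (σ p.2))
      (continuousAt_ofHomog hne) h1
  refine h2.congr ?_
  have e1 : ∀ᶠ p : SL2 × OnePoint ℂ in 𝓝 (A, w), ofHomog (σ p.2) = p.2 :=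
    (continuous_snd.tendsto (A, w)).eventually hev
  have e2 : ∀ᶠ p : SL2 × OnePoint ℂ in 𝓝 (A, w), σ p.2 ≠ 0 :=
    (ContinuousAt.comp (x := (A, w)) (g := σ) (f := Prod.snd) hσ
      continuous_snd.continuousAt).eventually_ne hσ0
  filter_upwards [e1, e2] with p h1 h2
  rw [← moebiusSL_ofHomog _ h2, h1]

lemma moebius_mk (A : SL2) : moebius (QuotientGroup.mk A) = moebiusSL A := rfl

/-- The projection from SL₂ to PSL₂ is open, so its product with the identity is still a quotient
map. -/
lemma continuous_moebius : Continuous fun p : PSL2 × OnePoint ℂ => moebius p.1 p.2 := by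
  have hq : IsOpenQuotientMap (Prod.map (QuotientGroup.mk : SL2 → PSL2) (id : OnePoint ℂ → _)) :=
    QuotientGroup.isOpenQuotientMap_mk.prodMap .id
  rw [hq.isQuotientMap.continuous_iff]
  exact continuous_moebiusSL

/-- One formula valid also at ∞, which makes continuity of the projection immediate. -/
lemma toSphere_ofHomog {v : ℂ × ℂ} (hv : v ≠ 0) : toSphere (ofHomog v) =
    !₂[2 * (v.1.re * v.2.re + v.1.im * v.2.im) / (Complex.normSq v.1 + Complex.normSq v.2),
      2 * (v.1.im * v.2.re - v.1.re * v.2.im) / (Complex.normSq v.1 + Complex.normSq v.2),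
      (Complex.normSq v.1 - Complex.normSq v.2) / (Complex.normSq v.1 + Complex.normSq v.2)] := by
  by_cases h : v.2 = 0
  · have hx : v.1 ≠ 0 := fun hx => hv (Prod.ext hx h)
    have hx2 : Complex.normSq v.1 ≠ 0 := by simpa using hx
    rw [ofHomog_of_eq h]
    change !₂[(0 : ℝ), 0, 1] = _
    simp [h, hx2]
  · rw [ofHomog_of_ne h]
    have hy2 : Complex.normSq v.2 ≠ 0 := by simpa using h
    have hs : Complex.normSq v.1 + Complex.normSq v.2 ≠ 0 := by
      have h1 := Complex.normSq_nonneg v.1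
      have h2 := Complex.normSq_pos.2 h
      positivity
    have hs' : Complex.normSq v.2 + Complex.normSq v.1 ≠ 0 := by rwa [add_comm]
    change !₂[2 * (v.1 / v.2).re / (1 + Complex.normSq (v.1 / v.2)),
      2 * (v.1 / v.2).im / (1 + Complex.normSq (v.1 / v.2)),
      (Complex.normSq (v.1 / v.2) - 1) / (1 + Complex.normSq (v.1 / v.2))] = _
    have e : 1 + Complex.normSq (v.1 / v.2) =
        (Complex.normSq v.1 + Complex.normSq v.2) / Complex.normSq v.2 := by
      rw [map_div₀]; field_simp; ring
    rw [e, Complex.div_re, Complex.div_im, map_div₀]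
    congr 1
    ext i
    fin_cases i
    · simp; field_simp
    · simp; field_simp
    · simp; field_simp

lemma continuous_toSphere : Continuous toSphere := by
  rw [continuous_iff_continuousAt]
  intro w
  obtain ⟨σ, hσ, hσ0, hσw, hev⟩ := exists_homog_lift w
  have hs : Complex.normSq (σ w).1 + Complex.normSq (σ w).2 ≠ 0 := by
    have h1 := Complex.normSq_nonneg (σ w).1
    have h2 := Complex.normSq_nonneg (σ w).2
    intro h
    apply hσ0
    exact Prod.ext (Complex.normSq_eq_zero.1 (by linarith)) (Complex.normSq_eq_zero.1 (by linarith))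
  have c1 : ContinuousAt (fun w => (σ w).1) w := hσ.fst
  have c2 : ContinuousAt (fun w => (σ w).2) w := hσ.snd
  have n1 : ContinuousAt (fun w => Complex.normSq (σ w).1) w :=
    Complex.continuous_normSq.continuousAt.comp' c1
  have n2 : ContinuousAt (fun w => Complex.normSq (σ w).2) w :=
    Complex.continuous_normSq.continuousAt.comp' c2
  have r1 : ContinuousAt (fun w => (σ w).1.re) w := Complex.continuous_re.continuousAt.comp' c1
  have r2 : ContinuousAt (fun w => (σ w).2.re) w := Complex.continuous_re.continuousAt.comp' c2
  have i1 : ContinuousAt (fun w => (σ w).1.im) w := Complex.continuous_im.continuousAt.comp' c1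
  have i2 : ContinuousAt (fun w => (σ w).2.im) w := Complex.continuous_im.continuousAt.comp' c2
  have key : ContinuousAt (fun w => (!₂[2 * ((σ w).1.re * (σ w).2.re + (σ w).1.im * (σ w).2.im) /
        (Complex.normSq (σ w).1 + Complex.normSq (σ w).2),
      2 * ((σ w).1.im * (σ w).2.re - (σ w).1.re * (σ w).2.im) /
        (Complex.normSq (σ w).1 + Complex.normSq (σ w).2),
      (Complex.normSq (σ w).1 - Complex.normSq (σ w).2) /
        (Complex.normSq (σ w).1 + Complex.normSq (σ w).2)] : EuclideanSpace ℝ (Fin 3))) w := by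
    refine (PiLp.continuous_toLp 2 _).continuousAt.comp' (continuousAt_pi.2 fun i => ?_)
    fin_cases i
    · exact (continuousAt_const.mul ((r1.mul r2).add (i1.mul i2))).div (n1.add n2) hs
    · exact (continuousAt_const.mul ((i1.mul r2).sub (r1.mul i2))).div (n1.add n2) hs
    · exact (n1.sub n2).div (n1.add n2) hs
  refine key.congr ?_
  filter_upwards [hev, hσ.eventually_ne hσ0] with u h1 h2
  rw [← toSphere_ofHomog h2, h1]

/-- A continuous injection of a compact space into a Hausdorff one. -/
lemma isEmbedding_toSphere : IsEmbedding toSphere :=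
  (continuous_toSphere.isClosedEmbedding toSphere_injective).isEmbedding

lemma continuous_sphereDist :
    Continuous fun p : OnePoint ℂ × OnePoint ℂ => sphereDist p.1 p.2 := by
  have h : (fun p : OnePoint ℂ × OnePoint ℂ => sphereDist p.1 p.2) =
      fun p => Real.arccos (inner ℝ (toSphere p.1) (toSphere p.2)) := by
    ext p
    simp [sphereDist, InnerProductGeometry.angle, norm_toSphere]
  rw [h]
  exact Real.continuous_arccos.comp ((continuous_toSphere.comp continuous_fst).inner
    (continuous_toSphere.comp continuous_snd))

/-- Angle and chord are related by ‖x - y‖² = 2 - 2 cos θ for unit vectors, so convergence in angle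
is convergence in space. -/
lemma tendsto_of_sphereDist {α : Type*} {l : Filter α} {w : α → OnePoint ℂ} {v : OnePoint ℂ}
    (h : Tendsto (fun a => sphereDist (w a) v) l (𝓝 0)) : Tendsto w l (𝓝 v) := by
  rw [isEmbedding_toSphere.tendsto_nhds_iff, tendsto_iff_norm_sub_tendsto_zero]
  have h1 : Tendsto (fun a => Real.sqrt (2 - 2 * Real.cos (sphereDist (w a) v))) l (𝓝 0) := by
    have hc : Continuous fun x : ℝ => Real.sqrt (2 - 2 * Real.cos x) := by fun_prop
    simpa [Function.comp_def] using (hc.tendsto 0).comp h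
  refine h1.congr fun a => ?_
  rw [Real.sqrt_eq_iff_eq_sq _ (norm_nonneg _)]
  · rw [Function.comp_apply, norm_sub_sq_real, norm_toSphere, norm_toSphere, sphereDist, InnerProductGeometry.cos_angle,
      norm_toSphere, norm_toSphere]
    ring
  · linarith [Real.cos_le_one (sphereDist (w a) v)]

end EllipticModuli
end

noncomputable section
open Filter Topology

namespace EllipticModuli

/-! ### Möbius transformations in the standard coordinates -/

@[simp] lemma coordAt_coe_coe (a w : ℂ) : coordAt (a : OnePoint ℂ) (w : OnePoint ℂ) = w - a := rfl
@[simp] lemma coordAt_coe_infty (a : ℂ) : coordAt (a : OnePoint ℂ) OnePoint.infty = 0 := rfl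
@[simp] lemma coordAt_infty_coe (w : ℂ) : coordAt OnePoint.infty (w : OnePoint ℂ) = w⁻¹ := rfl
@[simp] lemma coordAt_infty_infty : coordAt OnePoint.infty OnePoint.infty = 0 := rfl

lemma coordAt_self (w : OnePoint ℂ) : coordAt w w = 0 := by
  induction w using OnePoint.rec <;> simp

lemma eventually_ne_infty {a : ℂ} : ∀ᶠ w in 𝓝 (a : OnePoint ℂ), w ≠ OnePoint.infty :=
  isOpen_ne.mem_nhds (OnePoint.coe_ne_infty a)

lemma eventually_ne_zero : ∀ᶠ w in 𝓝 (OnePoint.infty : OnePoint ℂ), w ≠ ((0 : ℂ) : OnePoint ℂ) :=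
  isOpen_ne.mem_nhds (OnePoint.infty_ne_coe 0)

/-- In coordinates centred at a point and at its image, a Möbius map fixes 0 with nonzero
derivative. This form preserves analyticity and valency; the four cases are whether source and image
are ∞. -/
lemma coordAt_moebiusSL (A : SL2) (w₀ : OnePoint ℂ) : ∃ a c d : ℂ, a ≠ 0 ∧ d ≠ 0 ∧
    ∀ᶠ w in 𝓝 w₀, coordAt (moebiusSL A w₀) (moebiusSL A w) =
      a * coordAt w₀ w / (c * coordAt w₀ w + d) := by
  have hdet := det_SL2 A
  have hcont : Continuous (moebiusSL A) :=
    continuous_moebiusSL.comp (f := fun w => (A, w)) (by fun_prop)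
  generalize ha : A.1 0 0 = α at hdet
  generalize hb : A.1 0 1 = β at hdet
  generalize hc : A.1 1 0 = γ at hdet
  generalize hd : A.1 1 1 = δ at hdet
  induction w₀ using OnePoint.rec with
  | infty =>
    have hinf := moebiusSL_infty A
    rw [ha, hc] at hinf
    by_cases hγ : γ = 0
    · rw [if_pos hγ] at hinf
      subst hγ
      have hα : α ≠ 0 := by rintro rfl; simp at hdet
      have hδ : δ ≠ 0 := by rintro rfl; simp at hdet
      refine ⟨δ, β, α, hδ, hα, ?_⟩
      filter_upwards [eventually_ne_zero] with w hw
      rw [hinf]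
      induction w using OnePoint.rec with
      | infty => rw [hinf]; simp
      | coe u =>
        have hu : u ≠ 0 := fun h => hw (by rw [h])
        rw [moebiusSL_coe, ha, hb, hc, hd, if_neg (by simpa using hδ)]
        simp only [coordAt_infty_coe, zero_mul, zero_add, inv_div]
        have e : β * u⁻¹ + α = (α * u + β) / u := by field_simp; ring
        rw [e, div_div_eq_mul_div, mul_assoc, inv_mul_cancel₀ hu, mul_one]
    · rw [if_neg hγ] at hinf
      -- From (αu + β)/(γu + δ) - α/γ = -1/(γ(γu + δ)), rewritten in terms of u⁻¹.
      refine ⟨-1, γ * δ, γ * γ, by simp, mul_ne_zero hγ hγ, ?_⟩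
      have h1 : ∀ᶠ w in 𝓝 (OnePoint.infty : OnePoint ℂ), moebiusSL A w ≠ OnePoint.infty :=
        hcont.continuousAt.eventually_ne (by rw [hinf]; exact OnePoint.coe_ne_infty _)
      filter_upwards [eventually_ne_zero, h1] with w hw hw'
      rw [hinf]
      induction w using OnePoint.rec with
      | infty => rw [hinf]; simp
      | coe u =>
        have hu : u ≠ 0 := fun h => hw (by rw [h])
        rw [moebiusSL_coe, ha, hb, hc, hd] at hw' ⊢
        have hne : γ * u + δ ≠ 0 := fun h => hw' (if_pos h)
        rw [if_neg hne]
        simp only [coordAt_coe_coe, coordAt_infty_coe]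
        have e : γ * δ * u⁻¹ + γ * γ = γ * (γ * u + δ) / u := by field_simp; ring
        rw [e, div_sub_div _ _ hne hγ, div_div_eq_mul_div, mul_assoc, inv_mul_cancel₀ hu, mul_one,
          mul_comm (γ * u + δ) γ]
        congr 1
        linear_combination -hdet
  | coe a =>
    have ha' := moebiusSL_coe A a
    rw [ha, hb, hc, hd] at ha'
    by_cases hD : γ * a + δ = 0
    · rw [if_pos hD] at ha'
      have hγ : γ ≠ 0 := by
        rintro rfl
        rw [zero_mul, zero_add] at hD
        simp [hD] at hdet
      have hN : α * a + β ≠ 0 := by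
        intro h
        have : (1 : ℂ) = 0 := by
          linear_combination -hdet + α * hD - γ * h
        exact one_ne_zero this
      refine ⟨γ, α, α * a + β, hγ, hN, ?_⟩
      filter_upwards [eventually_ne_infty] with w hw
      rw [ha']
      induction w using OnePoint.rec with
      | infty => exact absurd rfl hw
      | coe u =>
        rw [moebiusSL_coe, ha, hb, hc, hd]
        simp only [coordAt_coe_coe]
        split_ifs with h
        · have : γ * (u - a) = 0 := by linear_combination h - hD
          rw [coordAt_infty_infty, this, zero_div]
        · rw [coordAt_infty_coe, inv_div]
          congr 1
          · linear_combination hD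
          · ring
    · rw [if_neg hD] at ha'
      -- The difference of the two values is (u - a)/((γu + δ)(γa + δ)), with the denominator
      -- expanded around `a`.
      refine ⟨1, (γ * a + δ) * γ, (γ * a + δ) * (γ * a + δ), one_ne_zero, mul_ne_zero hD hD, ?_⟩
      have h1 : ∀ᶠ w in 𝓝 (a : OnePoint ℂ), moebiusSL A w ≠ OnePoint.infty :=
        hcont.continuousAt.eventually_ne (by rw [ha']; exact OnePoint.coe_ne_infty _)
      filter_upwards [eventually_ne_infty, h1] with w hw hw'
      rw [ha']
      induction w using OnePoint.rec with
      | infty => exact absurd rfl hw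
      | coe u =>
        rw [moebiusSL_coe, ha, hb, hc, hd] at hw' ⊢
        have hne : γ * u + δ ≠ 0 := fun h => hw' (if_pos h)
        rw [if_neg hne]
        simp only [coordAt_coe_coe]
        have e : (γ * a + δ) * γ * (u - a) + (γ * a + δ) * (γ * a + δ) =
          (γ * u + δ) * (γ * a + δ) := by ring
        rw [e, div_sub_div _ _ hne hD]
        congr 1
        linear_combination (u - a) * hdet

/-! ### The action on elliptic functions -/

lemma exists_localRep_act (g : G) {W : Torus → OnePoint ℂ} (hW : Continuous W) (p : Torus) :
    ∃ a c d : ℂ, a ≠ 0 ∧ d ≠ 0 ∧ localRep (act g W) p =ᶠ[𝓝 0]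
      fun u => a * localRep W (p - g.2.toAdd) u / (c * localRep W (p - g.2.toAdd) u + d) := by
  obtain ⟨M, s⟩ := g
  obtain ⟨A, rfl⟩ := QuotientGroup.mk_surjective M
  obtain ⟨a, c, d, ha, hd, h⟩ := coordAt_moebiusSL A (W (p - s.toAdd))
  refine ⟨a, c, d, ha, hd, ?_⟩
  have hcont : Continuous fun u : ℂ => W (p - s.toAdd + (u : Torus)) :=
    hW.comp (continuous_const.add continuous_quot_mk)
  have h0 : W (p - s.toAdd + ((0 : ℂ) : Torus)) = W (p - s.toAdd) := by
    rw [QuotientAddGroup.mk_zero, add_zero]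
  have ht := hcont.tendsto 0
  rw [h0] at ht
  filter_upwards [ht.eventually h] with u hu
  have e : p + (u : Torus) - s.toAdd = p - s.toAdd + (u : Torus) := by abel
  simp only [localRep, act, moebius_mk, e]
  exact hu

lemma IsElliptic.act (g : G) {W : Torus → OnePoint ℂ} (hW : IsElliptic W) :
    IsElliptic (act g W) := by
  refine ⟨?_, fun p => ?_⟩
  · have h1 : Continuous fun z : Torus => (g.1, W (z - g.2.toAdd)) :=
      continuous_const.prodMk (hW.1.comp (continuous_id.sub continuous_const))
    exact continuous_moebius.comp h1
  · obtain ⟨a, c, d, ha, hd, h⟩ := exists_localRep_act g hW.1 p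
    refine AnalyticAt.congr ?_ h.symm
    have h1 := hW.2 (p - g.2.toAdd)
    refine (analyticAt_const.mul h1).div ((analyticAt_const.mul h1).add analyticAt_const) ?_
    simpa [localRep, coordAt_self] using hd

/-- The new local representative is the old one times an analytic unit. -/
lemma valency_act (g : G) {W : Torus → OnePoint ℂ} (hW : IsElliptic W) (p : Torus) :
    valency (act g W) p = valency W (p - g.2.toAdd) := by
  obtain ⟨a, c, d, ha, hd, h⟩ := exists_localRep_act g hW.1 p
  have h1 := hW.2 (p - g.2.toAdd)
  have h0 : localRep W (p - g.2.toAdd) 0 = 0 := by simp [localRep, coordAt_self]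
  rw [valency, analyticOrderAt_congr h, valency]
  have hS : AnalyticAt ℂ (fun u => a / (c * localRep W (p - g.2.toAdd) u + d)) 0 :=
    analyticAt_const.div ((analyticAt_const.mul h1).add analyticAt_const) (by simpa [h0] using hd)
  have e : (fun u => a * localRep W (p - g.2.toAdd) u / (c * localRep W (p - g.2.toAdd) u + d)) =
      localRep W (p - g.2.toAdd) * fun u => a / (c * localRep W (p - g.2.toAdd) u + d) := by
    ext u
    simp only [Pi.mul_apply]
    ring
  rw [e, analyticOrderAt_mul h1 hS, hS.analyticOrderAt_eq_zero.2, add_zero]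
  simp [h0, ha, hd]

/-- Translation maps the fibre over w bijectively onto the fibre of `W` over M⁻¹w, preserving
valencies. -/
lemma HasDegree.act (g : G) {W : Torus → OnePoint ℂ} (hW : IsElliptic W) {n : ℕ}
    (hn : HasDegree W n) : HasDegree (act g W) n := by
  intro w
  rw [← hn ((moebius g.1).symm w)]
  refine finsum_mem_eq_of_bijOn (fun p => p - g.2.toAdd) ?_ fun p _ => valency_act g hW p
  refine ⟨fun p hp => ?_, fun p _ q _ h => sub_left_injective h, fun p hp => ?_⟩
  · simp only [Set.mem_ofPred_eq, EllipticModuli.act] at hp ⊢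
    rw [← hp, Equiv.symm_apply_apply]
  · refine ⟨p + g.2.toAdd, ?_, add_sub_cancel_right _ _⟩
    simp only [Set.mem_ofPred_eq, EllipticModuli.act, add_sub_cancel_right] at hp ⊢
    rw [hp, Equiv.apply_symm_apply]

lemma act_one (W : Torus → OnePoint ℂ) : act 1 W = W := by
  ext z : 1
  simp [act]

lemma act_mul (g h : G) (W : Torus → OnePoint ℂ) : act (g * h) W = act g (act h W) := by
  ext z : 1
  simp only [act, Prod.fst_mul, Prod.snd_mul, map_mul, Equiv.Perm.mul_apply, toAdd_mul, sub_sub]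

/-! ### Matrices behind Möbius transformations -/

/-- The Möbius transformation given by an invertible matrix comes from `SL(2, ℂ)`. -/
lemma exists_moebiusSL_eq {a b c d : ℂ} (h : a * d - b * c ≠ 0) : ∃ A : SL2, ∀ w : ℂ,
    c * w + d ≠ 0 → moebiusSL A (w : OnePoint ℂ) = (((a * w + b) / (c * w + d) : ℂ) : OnePoint ℂ)
    := by
  -- Dividing the entries by a square root of the determinant normalises it to 1.
  obtain ⟨r, hr⟩ := IsAlgClosed.exists_pow_nat_eq (a * d - b * c) (n := 2) two_pos
  have hr0 : r ≠ 0 := by rintro rfl; exact h (by rw [← hr]; simp)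
  have hdet : (!![a / r, b / r; c / r, d / r] : Matrix (Fin 2) (Fin 2) ℂ).det = 1 := by
    rw [Matrix.det_fin_two_of]
    field_simp
    exact hr.symm
  obtain ⟨A, hA⟩ : ∃ A : SL2, A.1 = !![a / r, b / r; c / r, d / r] := ⟨⟨_, hdet⟩, rfl⟩
  refine ⟨A, fun w hw => ?_⟩
  have e : c / r * w + d / r = (c * w + d) / r := by ring
  have h00 : A.1 0 0 = a / r := by rw [hA]; rfl
  have h01 : A.1 0 1 = b / r := by rw [hA]; rfl
  have h10 : A.1 1 0 = c / r := by rw [hA]; rfl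
  have h11 : A.1 1 1 = d / r := by rw [hA]; rfl
  rw [moebiusSL_coe, h00, h01, h10, h11, e, if_neg (div_ne_zero hw hr0)]
  congr 1
  field_simp

/-- Only the identity of `PSL(2, ℂ)` acts trivially on the sphere. -/
lemma eq_one_of_moebius_eq {M : PSL2} (h : ∀ w, moebius M w = w) : M = 1 := by
  obtain ⟨A, rfl⟩ := QuotientGroup.mk_surjective M
  simp only [moebius_mk] at h
  have hdet := det_SL2 A
  -- Fixing ∞, 0 and 1 forces the matrix to be scalar, hence central.
  have hc : A.1 1 0 = 0 := by
    by_contra hc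
    have := h OnePoint.infty
    rw [moebiusSL_infty, if_neg hc] at this
    exact OnePoint.coe_ne_infty _ this
  rw [hc, mul_zero, sub_zero] at hdet
  have hd : A.1 1 1 ≠ 0 := right_ne_zero_of_mul_eq_one hdet
  have hz : ∀ z : ℂ, A.1 0 0 * z + A.1 0 1 = z * A.1 1 1 := fun z => by
    have := h z
    rw [moebiusSL_coe, hc, if_neg (by simpa using hd)] at this
    have := OnePoint.coe_injective this
    rw [zero_mul, zero_add, div_eq_iff hd] at this
    exact this
  have hb : A.1 0 1 = 0 := by simpa using hz 0
  have had : A.1 0 0 = A.1 1 1 := by simpa [hb] using hz 1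
  rw [QuotientGroup.eq_one_iff, Matrix.SpecialLinearGroup.mem_center_iff]
  refine ⟨A.1 1 1, ?_, ?_⟩
  · rw [had] at hdet
    rw [Fintype.card_fin, sq, hdet]
  · ext i j
    fin_cases i <;> fin_cases j <;> simp [hb, hc, had]

end EllipticModuli
end

noncomputable section
open Filter Topology

namespace EllipticModuli

/-! ### The square lattice -/

local notation "Λ" => PeriodPair.lattice gaussPeriods
local notation "℘" => PeriodPair.weierstrassP gaussPeriods

lemma mem_gauss {z : ℂ} : z ∈ Λ ↔ ∃ m n : ℤ, m + n * Complex.I = z := by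
  rw [PeriodPair.mem_lattice]
  have h1 : gaussPeriods.ω₁ = 1 := rfl
  have h2 : gaussPeriods.ω₂ = Complex.I := rfl
  simp only [h1, h2, mul_one]

lemma I_mul_mem {z : ℂ} (h : z ∈ Λ) : Complex.I * z ∈ Λ := by
  obtain ⟨m, n, rfl⟩ := mem_gauss.1 h
  refine mem_gauss.2 ⟨-n, m, ?_⟩
  push_cast
  linear_combination -(n : ℂ) * Complex.I_mul_I

/-- Multiplication by `i` as a symmetry of the square lattice. -/
def mulILattice : Λ ≃ Λ where
  toFun l := ⟨Complex.I * l, I_mul_mem l.2⟩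
  invFun l := ⟨-(Complex.I * l), neg_mem (I_mul_mem l.2)⟩
  left_inv l := by
    ext
    simp [← mul_assoc]
  right_inv l := by
    ext
    simp [← mul_assoc]

/-- Multiplication by i permutes the lattice, and each term of the series is homogeneous of degree
-2 in (z, l). -/
lemma weierstrassP_I_mul (z : ℂ) : ℘ (Complex.I * z) = -℘ z := by
  unfold PeriodPair.weierstrassP
  rw [← mulILattice.tsum_eq, ← tsum_neg]
  congr 1
  ext l
  have e : Complex.I * z - (mulILattice l : ℂ) = Complex.I * (z - l) := by
    simp only [mulILattice, Equiv.coe_fn_mk]; ring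
  rw [e]
  simp only [mulILattice, Equiv.coe_fn_mk, mul_pow, Complex.I_sq, neg_mul, one_mul, div_neg]
  ring

lemma half_one_notMem : (1 / 2 : ℂ) ∉ Λ := gaussPeriods.ω₁_div_two_notMem_lattice

lemma half_I_notMem : (Complex.I / 2 : ℂ) ∉ Λ := gaussPeriods.ω₂_div_two_notMem_lattice

lemma half_diag_notMem : ((1 + Complex.I) / 2 : ℂ) ∉ Λ := by
  rw [add_div]
  exact half_ω₁_add_half_ω₂_notMem (L := gaussPeriods)

lemma two_mul_half_one : 2 * (1 / 2 : ℂ) ∈ Λ := by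
  convert one_mem_lattice using 1; ring

lemma two_mul_half_diag : 2 * ((1 + Complex.I) / 2 : ℂ) ∈ Λ := by
  convert add_mem one_mem_lattice I_mem_lattice using 1; ring

/-- Multiplication by i fixes (1 + i)/2 modulo the lattice, so the value equals its own negative. -/
lemma weierstrassP_half_diag : ℘ ((1 + Complex.I) / 2) = 0 := by
  have h := weierstrassP_I_mul ((1 + Complex.I) / 2)
  have e : Complex.I * ((1 + Complex.I) / 2) = (1 + Complex.I) / 2 + -1 := by
    linear_combination (1 / 2 : ℂ) * Complex.I_mul_I
  rw [e, latticePeriodic_weierstrassP gaussPeriods _ (neg_mem one_mem_lattice)] at h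
  have : 2 * ℘ ((1 + Complex.I) / 2) = 0 := by linear_combination h
  simpa using this

lemma weierstrassP_half_I : ℘ (Complex.I / 2) = -e₁ := by
  rw [e₁, ← weierstrassP_I_mul]; congr 1; ring

/-- The value 0 is taken at (1 + i)/2, which is not ±1/2 modulo the lattice. -/
lemma e₁_ne_zero : e₁ ≠ 0 := by
  intro h
  rw [e₁, ← weierstrassP_half_diag] at h
  rcases sub_mem_or_add_mem_of_weierstrassP_eq half_diag_notMem half_one_notMem h with h | h
  · apply half_I_notMem
    convert neg_mem h using 1; ring
  · apply half_I_notMem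
    convert sub_mem h one_mem_lattice using 1; ring

/-- The constant is found at z = i/2: (-e₁ - e₁)(0 - e₁) = 2e₁². -/
lemma weierstrassP_translate_one {z : ℂ} (hz : z ∉ Λ) (hz' : z + 1 / 2 ∉ Λ) :
    (℘ z / e₁ - 1) * (℘ (z + 1 / 2) / e₁ - 1) = 2 := by
  obtain ⟨K, -, hK⟩ := exists_weierstrassP_half_translate half_one_notMem two_mul_half_one
  have h1 := hK z hz hz'
  have e : Complex.I / 2 + 1 / 2 = (1 + Complex.I) / 2 := by ring
  have h2 := hK (Complex.I / 2) half_I_notMem (by rw [e]; exact half_diag_notMem)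
  rw [e, weierstrassP_half_I, weierstrassP_half_diag] at h2
  rw [← h2, ← e₁] at h1
  have := e₁_ne_zero
  generalize ℘ (z + 1 / 2) = y at h1 ⊢
  field_simp
  linear_combination h1

/-- The constant is found at z = 1/2: e₁ · (-e₁). -/
lemma weierstrassP_translate_diag {z : ℂ} (hz : z ∉ Λ) (hz' : z + (1 + Complex.I) / 2 ∉ Λ) :
    ℘ z / e₁ * (℘ (z + (1 + Complex.I) / 2) / e₁) = -1 := by
  obtain ⟨K, -, hK⟩ := exists_weierstrassP_half_translate half_diag_notMem two_mul_half_diag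
  have h1 := hK z hz hz'
  have e : 1 / 2 + (1 + Complex.I) / 2 = Complex.I / 2 + 1 := by ring
  have hp := latticePeriodic_weierstrassP gaussPeriods 1 one_mem_lattice (Complex.I / 2)
  have h2 := hK (1 / 2) half_one_notMem (by
    rw [e]
    intro h
    exact half_I_notMem (by simpa using sub_mem h one_mem_lattice))
  rw [e, hp, weierstrassP_half_I, weierstrassP_half_diag, ← e₁] at h2
  rw [← h2, weierstrassP_half_diag] at h1
  have := e₁_ne_zero
  generalize ℘ (z + (1 + Complex.I) / 2) = y at h1 ⊢
  field_simp
  linear_combination h1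

/-! ### The torus -/

lemma torus_coe_eq_iff {a b : ℂ} : (a : Torus) = (b : Torus) ↔ a - b ∈ Λ := by
  rw [QuotientAddGroup.eq]
  change -a + b ∈ Λ ↔ _
  rw [← neg_mem_iff, show -(-a + b) = a - b by ring]

lemma torus_coe_eq_zero_iff {a : ℂ} : (a : Torus) = 0 ↔ a ∈ Λ := by
  rw [← QuotientAddGroup.mk_zero, torus_coe_eq_iff, sub_zero]

lemma torus_surj (p : Torus) : ∃ z : ℂ, (z : Torus) = p := QuotientAddGroup.mk_surjective p

lemma continuous_torus_coe : Continuous fun z : ℂ => (z : Torus) := continuous_quot_mk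

/-! ### The function `℘ / e₁` as an elliptic function -/

lemma wpNormalized_of_mem {z : ℂ} (hz : z ∈ Λ) : wpNormalized (z : Torus) = OnePoint.infty :=
  if_pos hz

lemma wpNormalized_of_notMem {z : ℂ} (hz : z ∉ Λ) :
    wpNormalized (z : Torus) = ((℘ z / e₁ : ℂ) : OnePoint ℂ) :=
  if_neg hz

lemma weierstrassP_of_mem {z : ℂ} (hz : z ∈ Λ) : ℘ z = 0 := gaussPeriods.weierstrassP_coe ⟨z, hz⟩

lemma wpNormalized_eq_iff (p q : Torus) :
    wpNormalized q = wpNormalized p ↔ q = p ∨ q = -p := by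
  obtain ⟨a, rfl⟩ := torus_surj p
  obtain ⟨b, rfl⟩ := torus_surj q
  rw [← QuotientAddGroup.mk_neg, torus_coe_eq_iff, torus_coe_eq_iff, sub_neg_eq_add]
  by_cases ha : a ∈ Λ <;> by_cases hb : b ∈ Λ
  · simp [wpNormalized_of_mem ha, wpNormalized_of_mem hb, sub_mem hb ha]
  · rw [wpNormalized_of_mem ha, wpNormalized_of_notMem hb]
    refine iff_of_false (OnePoint.coe_ne_infty _) ?_
    rintro (h | h)
    · exact hb (by simpa using add_mem h ha)
    · exact hb (by simpa using sub_mem h ha)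
  · rw [wpNormalized_of_mem hb, wpNormalized_of_notMem ha]
    refine iff_of_false (OnePoint.infty_ne_coe _) ?_
    rintro (h | h)
    · exact ha (by simpa using sub_mem hb h)
    · exact ha (by simpa using sub_mem h hb)
  · rw [wpNormalized_of_notMem hb, wpNormalized_of_notMem ha, OnePoint.coe_eq_coe,
      div_left_inj' e₁_ne_zero]
    refine ⟨fun h => sub_mem_or_add_mem_of_weierstrassP_eq ha hb h, ?_⟩
    rintro (h | h)
    · rw [← latticePeriodic_weierstrassP gaussPeriods _ h a]; congr 1; ring
    · rw [← gaussPeriods.weierstrassP_neg a, ← latticePeriodic_weierstrassP gaussPeriods _ h (-a)]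
      congr 1; ring

lemma wpNormalized_neg (p : Torus) : wpNormalized (-p) = wpNormalized p :=
  (wpNormalized_eq_iff p (-p)).2 (Or.inr rfl)

lemma wpNormalized_surjective : Function.Surjective wpNormalized := by
  intro w
  induction w using OnePoint.rec with
  | infty => exact ⟨((0 : ℂ) : Torus), wpNormalized_of_mem (zero_mem _)⟩
  | coe u =>
    obtain ⟨z, hz, h⟩ := exists_weierstrassP_eq (L := gaussPeriods) (u * e₁)
    refine ⟨(z : Torus), ?_⟩
    rw [wpNormalized_of_notMem hz, h, mul_div_cancel_right₀ _ e₁_ne_zero]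

lemma eventually_notMem {z : ℂ} (hz : z ∉ Λ) : ∀ᶠ w in 𝓝 z, w ∉ Λ :=
  gaussPeriods.isClosed_lattice.isOpen_compl.mem_nhds hz

lemma order_inv_weierstrassP {z : ℂ} (hz : z ∈ Λ) :
    meromorphicOrderAt (fun w => (℘ w / e₁)⁻¹) z = 2 := by
  have e : (fun w => (℘ w / e₁)⁻¹) = fun w => e₁ * (℘ w)⁻¹ := by
    ext w; rw [inv_div, div_eq_mul_inv]
  rw [e, fun_meromorphicOrderAt_mul (MeromorphicAt.const _ _)
    (gaussPeriods.meromorphic_weierstrassP z).fun_inv, fun_meromorphicOrderAt_inv,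
    gaussPeriods.order_weierstrassP z hz]
  classical
  rw [meromorphicOrderAt_const, if_neg e₁_ne_zero]
  rfl

/-- At lattice points ℘ has the default value 0, and 0⁻¹ = 0 is the true limit of the reciprocal, so
no correction of values is needed. -/
lemma analyticAt_inv_weierstrassP {z : ℂ} (hz : z ∈ Λ) :
    AnalyticAt ℂ (fun w => (℘ w / e₁)⁻¹) z := by
  refine AnalyticAt.of_meromorphicOrderAt_pos ?_ (by simp [weierstrassP_of_mem hz])
  rw [order_inv_weierstrassP hz]
  decide

lemma analyticOrderAt_inv_weierstrassP {z : ℂ} (hz : z ∈ Λ) :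
    analyticOrderAt (fun w => (℘ w / e₁)⁻¹) z = 2 := by
  have h := order_inv_weierstrassP hz
  rw [(analyticAt_inv_weierstrassP hz).meromorphicOrderAt_eq] at h
  cases e : analyticOrderAt (fun w => (℘ w / e₁)⁻¹) z with
  | top => rw [e] at h; exact absurd h (by decide)
  | coe n =>
    rw [e] at h
    simp only [ENat.map_natCast] at h
    have h' : (n : ℤ) = 2 := WithTop.coe_inj.1 h
    have : n = 2 := by exact_mod_cast h'
    rw [this]; rfl

lemma continuous_wpNormalized : Continuous wpNormalized := by
  have hq : IsOpenQuotientMap (fun z : ℂ => (z : Torus)) := QuotientAddGroup.isOpenQuotientMap_mk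
  rw [hq.isQuotientMap.continuous_iff, continuous_iff_continuousAt]
  intro z
  by_cases hz : z ∈ Λ
  -- Near a pole the map is read as (1 : e₁/℘), whose second coordinate is analytic.
  · have h1 : ContinuousAt (fun w : ℂ => ofHomog (1, (℘ w / e₁)⁻¹)) z :=
      ContinuousAt.comp (g := ofHomog) (f := fun w : ℂ => (1, (℘ w / e₁)⁻¹))
        (continuousAt_ofHomog (by simp))
        (continuousAt_const.prodMk (analyticAt_inv_weierstrassP hz).continuousAt)
    refine h1.congr ?_
    have h2 : ∀ᶠ w in 𝓝[≠] z, ℘ w ≠ 0 := by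
      refine (meromorphicOrderAt_ne_top_iff_eventually_ne_zero
        (gaussPeriods.meromorphic_weierstrassP z)).1 ?_
      rw [gaussPeriods.order_weierstrassP z hz]
      decide
    filter_upwards [eventually_nhdsWithin_iff.1 h2] with w hw
    simp only [Function.comp_apply]
    by_cases hwL : w ∈ Λ
    · rw [wpNormalized_of_mem hwL, ofHomog_of_eq (by simp [weierstrassP_of_mem hwL])]
    · have hP : ℘ w ≠ 0 := hw fun h => hwL (by rw [Set.mem_singleton_iff.1 h]; exact hz)
      rw [wpNormalized_of_notMem hwL, ofHomog_of_ne (by simp [hP, e₁_ne_zero])]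
      simp
  · have h1 : ContinuousAt (fun w : ℂ => ((℘ w / e₁ : ℂ) : OnePoint ℂ)) z :=
      OnePoint.continuous_coe.continuousAt.comp'
        ((analyticAt_weierstrassP hz).continuousAt.div_const _)
    refine h1.congr ?_
    filter_upwards [eventually_notMem hz] with w hw
    exact (wpNormalized_of_notMem hw).symm

lemma tendsto_add_nhds_zero (z : ℂ) : Tendsto (fun u : ℂ => z + u) (𝓝 0) (𝓝 z) := by
  have : Continuous fun u : ℂ => z + u := by fun_prop
  simpa using this.tendsto 0

lemma localRep_wpNormalized_of_mem {z : ℂ} (hz : z ∈ Λ) :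
    localRep wpNormalized (z : Torus) = fun u => (℘ (z + u) / e₁)⁻¹ := by
  ext u
  rw [localRep, wpNormalized_of_mem hz, ← QuotientAddGroup.mk_add]
  by_cases h : z + u ∈ Λ
  · rw [wpNormalized_of_mem h]
    simp [weierstrassP_of_mem h]
  · rw [wpNormalized_of_notMem h]
    rfl

lemma localRep_wpNormalized_of_notMem {z : ℂ} (hz : z ∉ Λ) :
    localRep wpNormalized (z : Torus) =ᶠ[𝓝 0] fun u => e₁⁻¹ * (℘ (z + u) - ℘ z) := by
  filter_upwards [(tendsto_add_nhds_zero z).eventually (eventually_notMem hz)] with u hu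
  rw [localRep, wpNormalized_of_notMem hz, ← QuotientAddGroup.mk_add, wpNormalized_of_notMem hu,
    coordAt_coe_coe]
  ring

lemma isElliptic_wpNormalized : IsElliptic wpNormalized := by
  refine ⟨continuous_wpNormalized, fun p => ?_⟩
  obtain ⟨z, rfl⟩ := torus_surj p
  by_cases hz : z ∈ Λ
  · rw [localRep_wpNormalized_of_mem hz]
    exact AnalyticAt.fun_comp (g := fun w => (℘ w / e₁)⁻¹) (f := fun u => z + u)
      (by simpa using analyticAt_inv_weierstrassP hz) (by fun_prop)
  · refine AnalyticAt.congr ?_ (localRep_wpNormalized_of_notMem hz).symm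
    have h1 : AnalyticAt ℂ (fun u => ℘ (z + u)) 0 :=
      AnalyticAt.fun_comp (g := ℘) (f := fun u => z + u)
        (by simpa using analyticAt_weierstrassP hz) (by fun_prop)
    exact analyticAt_const.mul (h1.sub analyticAt_const)

lemma analyticOrderAt_comp_const_add (f : ℂ → ℂ) (z : ℂ) :
    analyticOrderAt (fun u => f (z + u)) 0 = analyticOrderAt f z := by
  have := analyticOrderAt_comp_of_deriv_ne_zero (f := f) (g := fun u => z + u) (z₀ := (0 : ℂ))
    (by fun_prop) (by simp)
  simpa [Function.comp_def] using this

lemma valency_wpNormalized_of_notMem {z : ℂ} (hz : z ∉ Λ) :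
    valency wpNormalized (z : Torus) = analyticOrderAt (fun w => ℘ w - ℘ z) z := by
  rw [valency, analyticOrderAt_congr (localRep_wpNormalized_of_notMem hz)]
  have h1 : AnalyticAt ℂ (fun w => ℘ w - ℘ z) z := weierstrassP_sub_analyticAt hz _
  rw [analyticOrderAt_comp_const_add (fun w => e₁⁻¹ * (℘ w - ℘ z))]
  have := analyticOrderAt_mul (f := fun _ => e₁⁻¹) analyticAt_const h1
  rw [(analyticAt_const (v := e₁⁻¹) (x := z)).analyticOrderAt_eq_zero.2
    (inv_ne_zero e₁_ne_zero), zero_add] at this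
  exact this

lemma valency_wpNormalized_of_half {z : ℂ} (h2 : 2 * z ∈ Λ) :
    valency wpNormalized (z : Torus) = 2 := by
  by_cases hz : z ∈ Λ
  · rw [valency, localRep_wpNormalized_of_mem hz,
      analyticOrderAt_comp_const_add (fun w => (℘ w / e₁)⁻¹), analyticOrderAt_inv_weierstrassP hz]
  · rw [valency_wpNormalized_of_notMem hz, analyticOrderAt_weierstrassP_sub_of_half hz h2]

lemma valency_wpNormalized_of_not_half {z : ℂ} (h2 : 2 * z ∉ Λ) :
    valency wpNormalized (z : Torus) = 1 := by
  have hz : z ∉ Λ := fun h => h2 (by rw [two_mul]; exact add_mem h h)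
  rw [valency_wpNormalized_of_notMem hz, analyticOrderAt_weierstrassP_sub_of_not_half h2]

lemma hasDegree_wpNormalized : HasDegree wpNormalized 2 := by
  intro w
  obtain ⟨p, rfl⟩ := wpNormalized_surjective w
  have hset : {q : Torus | wpNormalized q = wpNormalized p} = {p, -p} := by
    ext q
    simp [wpNormalized_eq_iff p q]
  rw [hset]
  obtain ⟨z, rfl⟩ := torus_surj p
  have hneg : (z : Torus) = -(z : Torus) ↔ 2 * z ∈ Λ := by
    rw [← QuotientAddGroup.mk_neg, torus_coe_eq_iff, sub_neg_eq_add, two_mul]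
  by_cases h2 : 2 * z ∈ Λ
  · rw [← hneg.2 h2, Set.pair_eq_singleton, finsum_mem_singleton, valency_wpNormalized_of_half h2]
    rfl
  · rw [finsum_mem_pair (fun h => h2 (hneg.1 h)), valency_wpNormalized_of_not_half h2,
      ← QuotientAddGroup.mk_neg, valency_wpNormalized_of_not_half (by simpa using h2)]
    rfl

/-! ### The stabilizer of `℘ / e₁` -/

/-- The relation (x - 1)(y - 1) = 2 says y = (x + 1)/(x - 1), which is the map of `U₁`. -/
lemma act_g₁_wpNormalized : act g₁ wpNormalized = wpNormalized := by
  ext p : 1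
  obtain ⟨z, rfl⟩ := torus_surj p
  obtain ⟨w, rfl⟩ : ∃ w, w + 1 / 2 = z := ⟨z - 1 / 2, by ring⟩
  have e : ((w + 1 / 2 : ℂ) : Torus) - s₁ = (w : Torus) := by
    rw [s₁, ← QuotientAddGroup.mk_sub, add_sub_cancel_right]
  change moebiusSL U₁ (wpNormalized (((w + 1 / 2 : ℂ) : Torus) - s₁)) = _
  rw [e]
  have hk : (Complex.I / (Real.sqrt 2 : ℝ) : ℂ) ≠ 0 := fun h => by
    have := I_div_sq
    rw [h] at this
    norm_num at this
  set k : ℂ := Complex.I / (Real.sqrt 2 : ℝ) with hkdef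
  have h00 : U₁.1 0 0 = k := by simp [U₁, hkdef]
  have h01 : U₁.1 0 1 = k := by simp [U₁, hkdef]
  have h10 : U₁.1 1 0 = k := by simp [U₁, hkdef]
  have h11 : U₁.1 1 1 = -k := by simp [U₁, hkdef]
  by_cases hw : w ∈ Λ
  · have hw2 : w + 1 / 2 ∉ Λ := fun h => half_one_notMem (by simpa using sub_mem h hw)
    rw [wpNormalized_of_mem hw, wpNormalized_of_notMem hw2, moebiusSL_infty, h00, h10, if_neg hk,
      add_comm, latticePeriodic_weierstrassP gaussPeriods _ hw, ← e₁, div_self hk,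
      div_self e₁_ne_zero]
  by_cases hw2 : w + 1 / 2 ∈ Λ
  · have h1 : ℘ w = e₁ := by
      rw [e₁, ← gaussPeriods.weierstrassP_neg, ← latticePeriodic_weierstrassP gaussPeriods _ hw2]
      congr 1; ring
    rw [wpNormalized_of_mem hw2, wpNormalized_of_notMem hw, moebiusSL_coe, h10, h11, h1,
      div_self e₁_ne_zero, if_pos (by ring)]
  · have h := weierstrassP_translate_one hw hw2
    rw [wpNormalized_of_notMem hw2, wpNormalized_of_notMem hw, moebiusSL_coe, h00, h01, h10, h11]
    set x := ℘ w / e₁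
    set y := ℘ (w + 1 / 2) / e₁
    have hx : x - 1 ≠ 0 := left_ne_zero_of_mul (by rw [h]; norm_num : (x - 1) * (y - 1) ≠ 0)
    have hd : k * x + -k ≠ 0 := by
      rw [show k * x + -k = k * (x - 1) by ring]; exact mul_ne_zero hk hx
    rw [if_neg hd]
    congr 1
    rw [div_eq_iff hd]
    linear_combination -k * h

/-- The relation xy = -1 says y = -1/x, which is the map of `U₀`. -/
lemma act_g₀_wpNormalized : act g₀ wpNormalized = wpNormalized := by
  ext p : 1
  obtain ⟨z, rfl⟩ := torus_surj p
  obtain ⟨w, rfl⟩ : ∃ w, w + (1 + Complex.I) / 2 = z := ⟨z - (1 + Complex.I) / 2, by ring⟩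
  have e : ((w + (1 + Complex.I) / 2 : ℂ) : Torus) - s₀ = (w : Torus) := by
    rw [s₀, ← QuotientAddGroup.mk_sub, add_sub_cancel_right]
  change moebiusSL U₀ (wpNormalized (((w + (1 + Complex.I) / 2 : ℂ) : Torus) - s₀)) = _
  rw [e]
  have h00 : U₀.1 0 0 = 0 := rfl
  have h01 : U₀.1 0 1 = 1 := rfl
  have h10 : U₀.1 1 0 = -1 := rfl
  have h11 : U₀.1 1 1 = 0 := rfl
  by_cases hw : w ∈ Λ
  · have hw2 : w + (1 + Complex.I) / 2 ∉ Λ :=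
      fun h => half_diag_notMem (by simpa using sub_mem h hw)
    rw [wpNormalized_of_mem hw, wpNormalized_of_notMem hw2, moebiusSL_infty, h00, h10,
      if_neg (by norm_num), add_comm, latticePeriodic_weierstrassP gaussPeriods _ hw,
      weierstrassP_half_diag]
    simp
  by_cases hw2 : w + (1 + Complex.I) / 2 ∈ Λ
  · have h1 : ℘ w = 0 := by
      rw [← weierstrassP_half_diag, ← gaussPeriods.weierstrassP_neg,
        ← latticePeriodic_weierstrassP gaussPeriods _ hw2]
      congr 1; ring
    rw [wpNormalized_of_mem hw2, wpNormalized_of_notMem hw, moebiusSL_coe, h10, h11, h1,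
      if_pos (by ring)]
  · have h := weierstrassP_translate_diag hw hw2
    rw [wpNormalized_of_notMem hw2, wpNormalized_of_notMem hw, moebiusSL_coe, h00, h01, h10, h11]
    set x := ℘ w / e₁
    set y := ℘ (w + (1 + Complex.I) / 2) / e₁
    have hx : x ≠ 0 := left_ne_zero_of_mul (by rw [h]; norm_num : x * y ≠ 0)
    have hd : -1 * x + 0 ≠ 0 := by simpa using hx
    rw [if_neg hd]
    congr 1
    rw [div_eq_iff hd]
    linear_combination h

lemma act_wpNormalized_of_mem {g : G} (hg : g ∈ G₀) : act g wpNormalized = wpNormalized := by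
  rcases hg with rfl | rfl | rfl | rfl
  · exact act_one _
  · exact act_g₀_wpNormalized
  · exact act_g₁_wpNormalized
  · rw [← g₀_mul_g₁, act_mul, act_g₁_wpNormalized, act_g₀_wpNormalized]

lemma g₀_mem : g₀ ∈ G₀ := Or.inr (Or.inl rfl)
lemma g₁_mem : g₁ ∈ G₀ := Or.inr (Or.inr (Or.inl rfl))
lemma g₂_mem : g₂ ∈ G₀ := Or.inr (Or.inr (Or.inr rfl))

/-- Since ℘/e₁ is onto, the Möbius part fixes every point of the sphere. -/
lemma eq_one_of_act_eq {g : G} (hg : act g wpNormalized = wpNormalized) (hs : g.2.toAdd = 0) :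
    g = 1 := by
  refine Prod.ext (eq_one_of_moebius_eq fun w => ?_) hs
  obtain ⟨p, rfl⟩ := wpNormalized_surjective w
  have := congrFun hg p
  rwa [act, hs, sub_zero] at this

/-- Comparing invariance at z and at -z, and using evenness of ℘, shows that ℘ agrees at z + c and z
- c for all z. -/
lemma two_mul_translation_mem {M : PSL2} {c : ℂ}
    (hg : act (G.mk M (c : Torus)) wpNormalized = wpNormalized) : 2 * c ∈ Λ := by
  have key : ∀ z : Torus, wpNormalized (z + c) = wpNormalized (z - c) := fun z => by
    have h1 : moebius M (wpNormalized (z - c)) = wpNormalized z := congrFun hg z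
    have h2 : moebius M (wpNormalized (-z - c)) = wpNormalized (-z) := congrFun hg (-z)
    rw [wpNormalized_neg z, ← h1, show -z - (c : Torus) = -(z + c) by abel, wpNormalized_neg] at h2
    exact (moebius M).injective h2
  -- The point 1/4 is chosen because its double is not a period, which excludes z + c = -(z - c).
  rcases (wpNormalized_eq_iff _ _).1 (key ((1 / 4 : ℂ) : Torus)) with h | h
  · rw [← QuotientAddGroup.mk_add, ← QuotientAddGroup.mk_sub, torus_coe_eq_iff] at h
    convert h using 1; ring
  · rw [← QuotientAddGroup.mk_add, ← QuotientAddGroup.mk_sub, ← QuotientAddGroup.mk_neg,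
      torus_coe_eq_iff] at h
    exfalso
    apply half_one_notMem
    convert h using 1; ring

/-- A stabilizing translation is a half period, so multiplication by an element of `G₀` makes the
translation 0. -/
theorem act_wpNormalized_eq_iff (g : G) : act g wpNormalized = wpNormalized ↔ g ∈ G₀ := by
  refine ⟨fun hg => ?_, act_wpNormalized_of_mem⟩
  obtain ⟨M, s⟩ := g
  obtain ⟨c, hc⟩ := torus_surj s.toAdd
  have h2 : 2 * c ∈ Λ := two_mul_translation_mem (M := M) (by rw [hc]; exact hg)
  have key : ∀ h ∈ G₀, h.2.toAdd + (c : Torus) = 0 → ((M, s) : G) ∈ G₀ := fun h hh hs => by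
    have : h * (M, s) = 1 := by
      refine eq_one_of_act_eq ?_ ?_
      · rw [act_mul, hg, act_wpNormalized_of_mem hh]
      · rw [Prod.snd_mul, toAdd_mul, ← hc, hs]
    rw [eq_inv_of_mul_eq_one_right this]
    exact inv_mem hh
  by_cases h0 : c ∈ Λ
  · refine key 1 (one_mem _) ?_
    rw [Prod.snd_one, toAdd_one, zero_add]
    exact torus_coe_eq_zero_iff.2 h0
  rcases half_period_cases h2 h0 with h | h | h
  · refine key g₁ g₁_mem ((torus_coe_eq_zero_iff (a := 1 / 2 + c)).2 ?_)
    rw [add_comm]; exact h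
  · refine key g₂ g₂_mem ((torus_coe_eq_zero_iff (a := Complex.I / 2 + c)).2 ?_)
    rw [add_comm]; exact h
  · refine key g₀ g₀_mem ((torus_coe_eq_zero_iff (a := (1 + Complex.I) / 2 + c)).2 ?_)
    rw [add_comm, add_div]; exact h

/-- The translation parts alone distinguish the four elements, so matrices need not be compared. -/
lemma isKleinFour_G₀ : IsKleinFour G₀ := by
  have h1 : s₁ ≠ 0 := fun h => half_one_notMem (torus_coe_eq_zero_iff.1 h)
  have h2 : s₂ ≠ 0 := fun h => half_I_notMem (torus_coe_eq_zero_iff.1 h)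
  have h0 : s₀ ≠ 0 := fun h => half_diag_notMem (torus_coe_eq_zero_iff.1 h)
  have h01 : s₀ ≠ s₁ := fun h => half_I_notMem (by
    convert torus_coe_eq_iff.1 h using 1; ring)
  have h02 : s₀ ≠ s₂ := fun h => half_one_notMem (by
    convert torus_coe_eq_iff.1 h using 1; ring)
  have h12 : s₁ ≠ s₂ := fun h => half_diag_notMem (by
    convert add_mem (torus_coe_eq_iff.1 h) I_mem_lattice using 1; ring)
  have ne : ∀ {g h : G}, g.2.toAdd ≠ h.2.toAdd → g ≠ h := fun hgh e => hgh (by rw [e])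
  have e22 : g₂ * g₂ = 1 := by
    nth_rewrite 1 [← g₀_mul_g₁]
    rw [← g₁_mul_g₀, mul_assoc, ← mul_assoc g₁, g₁_mul_self, one_mul, g₀_mul_self]
  have hcard : Nat.card G₀ = 4 := by
    change Nat.card ({1, g₀, g₁, g₂} : Set G) = 4
    rw [Nat.card_coe_set_eq, Set.ncard_insert_of_notMem, Set.ncard_insert_of_notMem,
      Set.ncard_pair (ne (g := g₁) (h := g₂) h12)]
    · simp only [Set.mem_insert_iff, Set.mem_singleton_iff, not_or]
      exact ⟨ne (g := g₀) (h := g₁) h01, ne (g := g₀) (h := g₂) h02⟩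
    · simp only [Set.mem_insert_iff, Set.mem_singleton_iff, not_or]
      exact ⟨ne (g := 1) (h := g₀) h0.symm, ne (g := 1) (h := g₁) h1.symm,
        ne (g := 1) (h := g₂) h2.symm⟩
  refine ⟨hcard, ?_⟩
  have hdvd : Monoid.exponent G₀ ∣ 2 := by
    refine Monoid.exponent_dvd_of_forall_pow_eq_one ?_
    rintro ⟨g, hg⟩
    apply Subtype.ext
    simp only [sq, OneMemClass.coe_one]
    rcases hg with rfl | rfl | rfl | rfl
    · exact one_mul 1
    · exact g₀_mul_self
    · exact g₁_mul_self
    · exact e22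
  rcases (Nat.dvd_prime Nat.prime_two).1 hdvd with h | h
  · exfalso
    have := (Monoid.exp_eq_one_iff (G := G₀)).1 h
    rw [Nat.card_of_subsingleton (1 : G₀)] at hcard
    norm_num at hcard
  · exact h

end EllipticModuli
end

noncomputable section
open Filter Topology

namespace EllipticModuli

local notation "Λ" => PeriodPair.lattice gaussPeriods
local notation "℘" => PeriodPair.weierstrassP gaussPeriods

/-! ### Fibres of elliptic functions of degree two -/

lemma one_le_valency {W : Torus → OnePoint ℂ} (hW : IsElliptic W) (p : Torus) :
    1 ≤ valency W p :=
  Order.one_le_iff_ne_zero.2 (analyticOrderAt_ne_zero.2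
    ⟨hW.2 p, by simp [localRep, coordAt_self]⟩)

lemma fibre_of_degree_two {W : Torus → OnePoint ℂ} (hW : IsElliptic W) (h2 : HasDegree W 2)
    (w : OnePoint ℂ) :
    (∃ p, {q | W q = w} = {p} ∧ valency W p = 2) ∨
      ∃ p q, p ≠ q ∧ {r | W r = w} = {p, q} ∧ valency W p = 1 ∧ valency W q = 1 := by
  classical
  have h := h2 w
  have hfin : {p | W p = w}.Finite := by
    by_contra hinf
    -- Valencies are never 0, so an infinite fibre would give an infinite support and the default
    -- sum 0.
    rw [finsum_mem_eq_zero_of_infinite] at h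
    · norm_num at h
    · rwa [Set.inter_eq_left.2 (show _ ⊆ Function.support (valency W) from
        fun p _ => Order.one_le_iff_ne_zero.1 (one_le_valency hW p))]
  rw [finsum_mem_eq_finite_toFinset_sum _ hfin] at h
  set T := hfin.toFinset with hT
  have hTS : {p | W p = w} = (T : Set Torus) := hfin.coe_toFinset.symm
  have hcard : T.card ≤ 2 := by
    have h1 : ∑ p ∈ T, (1 : ℕ∞) ≤ ∑ p ∈ T, valency W p :=
      Finset.sum_le_sum fun p _ => one_le_valency hW p
    rw [h, Finset.sum_const, nsmul_one] at h1
    exact_mod_cast h1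
  interval_cases hc : T.card
  · rw [Finset.card_eq_zero.1 hc, Finset.sum_empty] at h
    norm_num at h
  · obtain ⟨p, hp⟩ := Finset.card_eq_one.1 hc
    rw [hp, Finset.sum_singleton] at h
    exact Or.inl ⟨p, by rw [hTS, hp, Finset.coe_singleton], h⟩
  · obtain ⟨p, q, hpq, hp⟩ := Finset.card_eq_two.1 hc
    rw [hp, Finset.sum_pair hpq] at h
    refine Or.inr ⟨p, q, hpq, by rw [hTS, hp, Finset.coe_pair], ?_⟩
    have h1 := one_le_valency hW p
    have h1' := one_le_valency hW q
    have htop1 : valency W p ≠ ⊤ := fun e => by rw [e, top_add] at h; exact absurd h (by decide)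
    have htop2 : valency W q ≠ ⊤ := fun e => by rw [e, add_top] at h; exact absurd h (by decide)
    obtain ⟨m, hm⟩ := ENat.ne_top_iff_exists.1 htop1
    obtain ⟨n, hn⟩ := ENat.ne_top_iff_exists.1 htop2
    rw [← hm, ← hn] at h
    rw [← hm] at h1 ⊢
    rw [← hn] at h1' ⊢
    have a1 : 1 ≤ m := by exact_mod_cast h1
    have a2 : 1 ≤ n := by exact_mod_cast h1'
    have a3 : m + n = 2 := by exact_mod_cast h
    obtain ⟨rfl, rfl⟩ : m = 1 ∧ n = 1 := by omega
    exact ⟨rfl, rfl⟩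

lemma fibre_finite {W : Torus → OnePoint ℂ} (hW : IsElliptic W) (h2 : HasDegree W 2)
    (w : OnePoint ℂ) : {q | W q = w}.Finite := by
  rcases fibre_of_degree_two hW h2 w with ⟨p, h, -⟩ | ⟨p, q, -, h, -⟩
  · rw [h]; exact Set.finite_singleton p
  · rw [h]; exact Set.toFinite _

/-! ### The meromorphic function on the plane given by an elliptic function -/

/-- The finite part of `W`, as a function on the plane, with value `0` at the poles. -/
def finitePart (W : Torus → OnePoint ℂ) (z : ℂ) : ℂ := (W (z : Torus)).elim 0 id

lemma finitePart_of_eq {W : Torus → OnePoint ℂ} {z a : ℂ} (h : W (z : Torus) = (a : OnePoint ℂ)) :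
    finitePart W z = a := by
  rw [finitePart, h]; rfl

lemma finitePart_of_infty {W : Torus → OnePoint ℂ} {z : ℂ} (h : W (z : Torus) = OnePoint.infty) :
    finitePart W z = 0 := by
  rw [finitePart, h]; rfl

lemma coe_finitePart {W : Torus → OnePoint ℂ} {z : ℂ} (h : W (z : Torus) ≠ OnePoint.infty) :
    W (z : Torus) = (finitePart W z : OnePoint ℂ) := by
  obtain ⟨a, ha⟩ := OnePoint.ne_infty_iff_exists.1 h
  rw [finitePart_of_eq ha.symm, ha]

lemma latticePeriodic_finitePart (W : Torus → OnePoint ℂ) :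
    LatticePeriodic gaussPeriods (finitePart W) := fun l hl z => by
  have : ((z + l : ℂ) : Torus) = (z : Torus) := torus_coe_eq_iff.2 (by simpa using hl)
  rw [finitePart, this, finitePart]

lemma coe_add_coe_sub (z w : ℂ) : (z : Torus) + ((w - z : ℂ) : Torus) = (w : Torus) := by
  rw [← QuotientAddGroup.mk_add, add_sub_cancel]

variable {W : Torus → OnePoint ℂ}

lemma analyticAt_finitePart (hW : IsElliptic W) {z : ℂ} (hz : W (z : Torus) ≠ OnePoint.infty) :
    AnalyticAt ℂ (finitePart W) z := by
  obtain ⟨a, ha⟩ := OnePoint.ne_infty_iff_exists.1 hz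
  have h1 : AnalyticAt ℂ (fun w => localRep W (z : Torus) (w - z) + a) z := by
    refine AnalyticAt.add ?_ analyticAt_const
    exact AnalyticAt.fun_comp (g := localRep W (z : Torus)) (f := fun w => w - z)
      (by simpa using hW.2 (z : Torus)) (by fun_prop)
  refine h1.congr ?_
  have h2 : ∀ᶠ w : ℂ in 𝓝 z, W (w : Torus) ≠ OnePoint.infty :=
    (hW.1.comp continuous_torus_coe).continuousAt.eventually_ne hz
  filter_upwards [h2] with w hw
  rw [localRep, coe_add_coe_sub, coe_finitePart hw, ← ha, coordAt_coe_coe, sub_add_cancel]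

/-- The equality holds on the whole plane because both sides are 0 at every pole. -/
lemma finitePart_eq_inv {z : ℂ} (hz : W (z : Torus) = OnePoint.infty) :
    finitePart W = fun w => (localRep W (z : Torus) (w + -z))⁻¹ := by
  ext w
  rw [localRep, ← sub_eq_add_neg, coe_add_coe_sub, hz]
  by_cases h : W (w : Torus) = OnePoint.infty
  · rw [finitePart_of_infty h, h, coordAt_infty_infty, inv_zero]
  · rw [coe_finitePart h, coordAt_infty_coe, inv_inv]

lemma meromorphic_finitePart (hW : IsElliptic W) : Meromorphic (finitePart W) := by
  intro z
  by_cases hz : W (z : Torus) = OnePoint.infty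
  · rw [finitePart_eq_inv hz]
    refine MeromorphicAt.fun_inv (AnalyticAt.meromorphicAt ?_)
    exact AnalyticAt.fun_comp (g := localRep W (z : Torus)) (f := fun w => w + -z)
      (by simpa using hW.2 (z : Torus)) (by fun_prop)
  · exact (analyticAt_finitePart hW hz).meromorphicAt

lemma order_finitePart (hW : IsElliptic W) {z : ℂ} (hz : W (z : Torus) = OnePoint.infty) {n : ℕ}
    (hn : valency W (z : Torus) = n) :
    meromorphicOrderAt (finitePart W) z = ((-n : ℤ) : WithTop ℤ) := by
  rw [finitePart_eq_inv hz, fun_meromorphicOrderAt_inv, meromorphicOrderAt_comp_add,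
    add_neg_cancel, (hW.2 (z : Torus)).meromorphicOrderAt_eq]
  rw [valency] at hn
  rw [hn]
  rfl

/-! ### Every elliptic function of degree two is in the orbit of `℘ / e₁` -/

lemma eventually_notMem_nhdsNE (x : ℂ) : ∀ᶠ z in 𝓝[≠] x, z ∉ Λ := by
  have := gaussPeriods.compl_lattice_sdiff_singleton_mem_nhds x
  rw [eventually_nhdsWithin_iff]
  filter_upwards [this] with z hz hzx hzL
  exact hz ⟨hzL, hzx⟩

lemma tendsto_sub_nhdsNE (x m : ℂ) : Tendsto (fun z => z - m) (𝓝[≠] x) (𝓝[≠] (x - m)) := by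
  refine tendsto_nhdsWithin_iff.2 ⟨?_, ?_⟩
  · have : ContinuousAt (fun z => z - m) x := by fun_prop
    exact this.tendsto.mono_left nhdsWithin_le_nhds
  · filter_upwards [self_mem_nhdsWithin] with z hz
    simpa using hz

/-- At a pole `finitePart` has finite order, so it is nonzero nearby; since it is 0 at poles by
default, there are no other poles nearby. -/
lemma eventually_ne_infty_nhdsNE (hW : IsElliptic W) (h2 : HasDegree W 2) (x : ℂ) :
    ∀ᶠ z : ℂ in 𝓝[≠] x, W (z : Torus) ≠ OnePoint.infty := by
  by_cases hx : W (x : Torus) = OnePoint.infty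
  · have htop : meromorphicOrderAt (finitePart W) x ≠ ⊤ := by
      have hmem : (x : Torus) ∈ {q | W q = OnePoint.infty} := hx
      rcases fibre_of_degree_two hW h2 OnePoint.infty with ⟨p, h, hp⟩ | ⟨p, q, -, h, hp, hq⟩
      · rw [h, Set.mem_singleton_iff] at hmem
        rw [order_finitePart hW hx (n := 2) (by rw [hmem, hp]; rfl)]
        exact WithTop.coe_ne_top
      · rw [h] at hmem
        rw [order_finitePart hW hx (n := 1)]
        · exact WithTop.coe_ne_top
        · rcases hmem with e | e
          · rw [e, hp]; rfl
          · rw [Set.mem_singleton_iff.1 e, hq]; rfl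
    refine ((meromorphicOrderAt_ne_top_iff_eventually_ne_zero
      (meromorphic_finitePart hW x)).1 htop).mono fun z hz hinf => hz (finitePart_of_infty hinf)
  · exact ((hW.1.comp continuous_torus_coe).continuousAt.eventually_ne hx).filter_mono
      nhdsWithin_le_nhds

/-- Two continuous maps to the sphere that agree off isolated points are equal, so the formula for W
is needed only generically. The factors `e₁` in the matrix undo the normalisation of ℘. -/
lemma exists_act_eq_of_finitePart (hW : IsElliptic W) (h2 : HasDegree W 2) {a b c d m : ℂ}
    (hdet : a * d - b * c ≠ 0)
    (h : ∀ x, ∀ᶠ z in 𝓝[≠] x, c * ℘ (z - m) + d ≠ 0 ∧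
      finitePart W z = (a * ℘ (z - m) + b) / (c * ℘ (z - m) + d)) :
    ∃ g, W = act g wpNormalized := by
  obtain ⟨A, hA⟩ := exists_moebiusSL_eq (a := a * e₁) (b := b) (c := c * e₁) (d := d) (by
    rw [show a * e₁ * d - b * (c * e₁) = (a * d - b * c) * e₁ by ring]
    exact mul_ne_zero hdet e₁_ne_zero)
  refine ⟨G.mk (QuotientGroup.mk A) (m : Torus), ?_⟩
  have hV := isElliptic_wpNormalized.act (G.mk (QuotientGroup.mk A) (m : Torus))
  ext p : 1
  obtain ⟨x, rfl⟩ := torus_surj p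
  have t1 : Tendsto (fun z : ℂ => W (z : Torus)) (𝓝[≠] x) (𝓝 (W (x : Torus))) :=
    ((hW.1.comp continuous_torus_coe).tendsto x).mono_left nhdsWithin_le_nhds
  have t2 := ((hV.1.comp continuous_torus_coe).tendsto x).mono_left
    (nhdsWithin_le_nhds (s := {x}ᶜ))
  refine tendsto_nhds_unique t1 (t2.congr' ?_)
  filter_upwards [h x, eventually_ne_infty_nhdsNE hW h2 x,
    (tendsto_sub_nhdsNE x m).eventually (eventually_notMem_nhdsNE (x - m))] with z h1 h3 h4
  have he := e₁_ne_zero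
  change moebiusSL A (wpNormalized ((z : Torus) - (m : Torus))) = _
  rw [← QuotientAddGroup.mk_sub, wpNormalized_of_notMem h4, coe_finitePart h3, h1.2]
  have e1 : c * e₁ * (℘ (z - m) / e₁) = c * ℘ (z - m) := by field_simp
  have e2 : a * e₁ * (℘ (z - m) / e₁) = a * ℘ (z - m) := by field_simp
  rw [hA _ (by rw [e1]; exact h1.1), e1, e2]

/-- Subtracting c ℘(z - m) leaves at most a simple pole, so W = c ℘(z - m) + k. -/
lemma exists_act_eq_of_double (hW : IsElliptic W) (h2 : HasDegree W 2) {p : Torus}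
    (hp : {q | W q = OnePoint.infty} = {p}) (hv : valency W p = 2) :
    ∃ g, W = act g wpNormalized := by
  obtain ⟨m, rfl⟩ := torus_surj p
  have hinf : ∀ z : ℂ, W (z : Torus) = OnePoint.infty ↔ z - m ∈ Λ := fun z => by
    rw [← torus_coe_eq_iff]
    exact Set.ext_iff.1 hp (z : Torus)
  have hF := meromorphic_finitePart hW
  have hFm : meromorphicOrderAt (finitePart W) m = ((-2 : ℤ) : WithTop ℤ) :=
    order_finitePart hW ((hinf m).2 (by simp)) (n := 2) hv
  have hgm : Meromorphic fun z => ℘ (z + -m) :=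
    meromorphic_comp_add gaussPeriods.meromorphic_weierstrassP (-m)
  have hgo : meromorphicOrderAt (fun z => ℘ (z + -m)) m = ((-2 : ℤ) : WithTop ℤ) := by
    rw [meromorphicOrderAt_comp_add, add_neg_cancel,
      gaussPeriods.order_weierstrassP 0 (zero_mem _)]
    rfl
  obtain ⟨c, hc, hord⟩ := exists_lt_meromorphicOrderAt_sub (hF m) (hgm m) hFm hgo
  have hcg : Meromorphic fun z => c * ℘ (z + -m) := fun z => (MeromorphicAt.const c z).fun_mul (hgm z)
  obtain ⟨k, hk⟩ := exists_const_of_simple_pole_at (L := gaussPeriods)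
    (fun z => (hF z).fun_sub (hcg z)) ((latticePeriodic_finitePart W).sub
      ((LatticePeriodic.const c).mul ((latticePeriodic_weierstrassP _).comp_add (-m)))) m
    (fun z hz => by
      refine le_meromorphicOrderAt_sub (hF z) (hcg z) ?_ ?_
      · exact (analyticAt_finitePart hW fun h => hz ((hinf z).1 h)).meromorphicOrderAt_nonneg
      · refine AnalyticAt.meromorphicOrderAt_nonneg (analyticAt_const.mul ?_)
        exact AnalyticAt.fun_comp (g := ℘) (f := fun w => w + -m)
          (analyticAt_weierstrassP (by rwa [← sub_eq_add_neg])) (by fun_prop))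
    hord
  refine exists_act_eq_of_finitePart hW h2 (a := c) (b := k) (c := 0) (d := 1) (m := m)
    (by simpa using hc) fun x => ?_
  filter_upwards [hk x] with z hz
  rw [← sub_eq_add_neg] at hz
  refine ⟨by simp, ?_⟩
  simp only [zero_mul, zero_add, div_one]
  linear_combination hz

/-- The function 1/(℘(z - m) - ℘ b) has the same simple poles as W. Cancelling the one at p leaves
at most a simple pole at q, so a constant remains. -/
lemma exists_act_eq_of_simple (hW : IsElliptic W) (h2 : HasDegree W 2) {p q : Torus} (hpq : p ≠ q)
    (hset : {r | W r = OnePoint.infty} = {p, q}) (hvp : valency W p = 1) (hvq : valency W q = 1) :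
    ∃ g, W = act g wpNormalized := by
  obtain ⟨p, rfl⟩ := torus_surj p
  obtain ⟨q, rfl⟩ := torus_surj q
  have hinf : ∀ z : ℂ, W (z : Torus) = OnePoint.infty ↔ z - p ∈ Λ ∨ z - q ∈ Λ := fun z => by
    rw [← torus_coe_eq_iff, ← torus_coe_eq_iff, ← Set.mem_singleton_iff (b := (q : Torus)),
      ← Set.mem_insert_iff, ← hset]; rfl
  -- Centred at the midpoint, the poles become ±b, where ℘ - ℘ b has its zeros; they are simple
  -- because p ≠ q on the torus.
  set m := (p + q) / 2 with hm
  set b := (p - q) / 2 with hb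
  have hpm : p = m + b := by rw [hm, hb]; ring
  have hqm : q = m - b := by rw [hm, hb]; ring
  have hb2 : 2 * b ∉ Λ := fun h => hpq (torus_coe_eq_iff.2 (by
    convert h using 1; rw [hb]; ring))
  have hbL : b ∉ Λ := fun h => hb2 (by rw [two_mul]; exact add_mem h h)
  have hF := meromorphic_finitePart hW
  have hFp : meromorphicOrderAt (finitePart W) p = ((-1 : ℤ) : WithTop ℤ) :=
    order_finitePart hW ((hinf p).2 (by simp)) (n := 1) hvp
  have hFq : meromorphicOrderAt (finitePart W) q = ((-1 : ℤ) : WithTop ℤ) :=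
    order_finitePart hW ((hinf q).2 (by simp)) (n := 1) hvq
  have hPm : Meromorphic fun z => ℘ z - ℘ b := meromorphic_weierstrassP_sub _
  have hgm : Meromorphic fun z => (℘ (z + -m) - ℘ b)⁻¹ := fun z =>
    (meromorphic_comp_add hPm (-m) z).fun_inv
  have hord : ∀ z, meromorphicOrderAt (fun z => (℘ (z + -m) - ℘ b)⁻¹) z =
      -meromorphicOrderAt (fun z => ℘ z - ℘ b) (z + -m) := fun z => by
    rw [fun_meromorphicOrderAt_inv, meromorphicOrderAt_comp_add (fun z => ℘ z - ℘ b)]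
  have hob : meromorphicOrderAt (fun z => ℘ z - ℘ b) b = 1 := order_weierstrassP_sub_of_not_half hb2
  have honb : meromorphicOrderAt (fun z => ℘ z - ℘ b) (-b) = 1 := by
    rw [← meromorphicOrderAt_comp_neg]
    simp only [gaussPeriods.weierstrassP_neg]
    exact hob
  have hgp : meromorphicOrderAt (fun z => (℘ (z + -m) - ℘ b)⁻¹) p = ((-1 : ℤ) : WithTop ℤ) := by
    rw [hord, show p + -m = b by rw [hpm]; ring, hob]; rfl
  have hgq : meromorphicOrderAt (fun z => (℘ (z + -m) - ℘ b)⁻¹) q = ((-1 : ℤ) : WithTop ℤ) := by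
    rw [hord, show q + -m = -b by rw [hqm]; ring, honb]; rfl
  have hgper : LatticePeriodic gaussPeriods fun z => (℘ (z + -m) - ℘ b)⁻¹ :=
    ((latticePeriodic_weierstrassP_sub (L := gaussPeriods) (℘ b)).comp_add (-m)).inv
  obtain ⟨c, hc, hordp⟩ := exists_lt_meromorphicOrderAt_sub (hF p) (hgm p) hFp hgp
  have hcg : Meromorphic fun z => c * (℘ (z + -m) - ℘ b)⁻¹ := fun z =>
    (MeromorphicAt.const c z).fun_mul (hgm z)
  have hper : LatticePeriodic gaussPeriods fun z =>
      finitePart W z - c * (℘ (z + -m) - ℘ b)⁻¹ :=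
    (latticePeriodic_finitePart W).sub ((LatticePeriodic.const c).mul hgper)
  obtain ⟨k, hk⟩ := exists_const_of_simple_pole_at (L := gaussPeriods)
    (fun z => (hF z).fun_sub (hcg z)) hper q
    (fun z hz => by
      by_cases hzp : z - p ∈ Λ
      · have := hper.order_eq hzp p
        rw [add_sub_cancel] at this
        rw [this]
        exact hordp
      refine le_meromorphicOrderAt_sub (hF z) (hcg z) ?_ ?_
      · exact (analyticAt_finitePart hW fun h => ((hinf z).1 h).elim hzp hz).meromorphicOrderAt_nonneg
      · rw [← add_zero (0 : WithTop ℤ)]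
        refine le_meromorphicOrderAt_mul (MeromorphicAt.const c z) (hgm z)
          (le_meromorphicOrderAt_const c z) ?_
        by_cases hzm : z + -m ∈ Λ
        · rw [hord, order_weierstrassP_sub hzm]; decide
        · refine AnalyticAt.meromorphicOrderAt_nonneg (AnalyticAt.fun_inv ?_ ?_)
          · exact AnalyticAt.fun_comp (g := fun z => ℘ z - ℘ b) (f := fun w => w + -m)
              (weierstrassP_sub_analyticAt hzm _) (by fun_prop)
          · intro h0
            rcases sub_mem_or_add_mem_of_weierstrassP_eq hbL hzm (sub_eq_zero.1 h0) with h | h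
            · exact hzp (by convert h using 1; rw [hpm]; ring)
            · exact hz (by convert h using 1; rw [hqm]; ring))
    (by
      refine le_meromorphicOrderAt_sub (hF q) (hcg q) hFq.ge ?_
      have := le_meromorphicOrderAt_mul (MeromorphicAt.const c q) (hgm q)
        (le_meromorphicOrderAt_const c q) hgq.ge
      exact this)
  -- This is k + c/(℘ - ℘ b) over a common denominator, with determinant -c.
  refine exists_act_eq_of_finitePart hW h2 (a := k) (b := c - k * ℘ b) (c := 1) (d := -℘ b) (m := m)
    (by ring_nf; simpa using hc) fun x => ?_
  have hne : ∀ᶠ z in 𝓝[≠] (x - m), ℘ z - ℘ b ≠ 0 :=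
    (meromorphicOrderAt_ne_top_iff_eventually_ne_zero (hPm (x - m))).1
      (order_weierstrassP_sub_ne_top _ _)
  filter_upwards [hk x, (tendsto_sub_nhdsNE x m).eventually hne] with z hz hz0
  rw [← sub_eq_add_neg] at hz
  rw [one_mul, ← sub_eq_add_neg]
  refine ⟨hz0, ?_⟩
  rw [eq_div_iff hz0, sub_eq_iff_eq_add.1 hz, add_mul, mul_assoc, inv_mul_cancel₀ hz0]
  ring

/-- Every elliptic function of degree two is a Möbius transform of a translate of `℘ / e₁`. -/
theorem exists_act_eq (hW : IsElliptic W) (h2 : HasDegree W 2) :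
    ∃ g, W = act g wpNormalized := by
  rcases fibre_of_degree_two hW h2 OnePoint.infty with ⟨p, h, hp⟩ | ⟨p, q, hpq, h, hp, hq⟩
  · exact exists_act_eq_of_double hW h2 h hp
  · exact exists_act_eq_of_simple hW h2 hpq h hp hq

end EllipticModuli
end

noncomputable section
open Filter Topology

namespace EllipticModuli

/-! ### The orbit map -/

instance : CompactSpace Torus := by
  have h := IsZLattice.isCompact_range_of_periodic gaussPeriods.lattice
    (fun z : ℂ => (z : Torus)) continuous_torus_coe
    (fun z w hw => torus_coe_eq_iff.2 (by simpa using hw))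
  rw [Set.range_eq_univ.2 torus_surj] at h
  exact ⟨h⟩

instance : Infinite Torus :=
  have : Infinite (OnePoint ℂ) :=
    Infinite.of_injective _ (OnePoint.coe_injective (X := ℂ))
  Infinite.of_surjective _ wpNormalized_surjective

/-- The orbit map `g ↦ (℘ / e₁)_g`. -/
def orbitMap (g : G) : M₂ :=
  ⟨act g wpNormalized, isElliptic_wpNormalized.act g,
    hasDegree_wpNormalized.act g isElliptic_wpNormalized⟩

lemma orbitMap_apply (g : G) (z : Torus) :
    orbitMap g z = moebius g.1 (wpNormalized (z - g.2.toAdd)) := rfl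

lemma orbitMap_eq_iff (g h : G) : orbitMap g = orbitMap h ↔ g⁻¹ * h ∈ G₀ := by
  rw [← act_wpNormalized_eq_iff, act_mul, M₂.ext_iff]
  change act g wpNormalized = act h wpNormalized ↔ _
  constructor
  · intro e
    rw [← e, ← act_mul, inv_mul_cancel, act_one]
  · intro e
    rw [← e, ← act_mul, mul_inv_cancel, act_one, e]

lemma orbitMap_surjective : Function.Surjective orbitMap := fun W => by
  obtain ⟨g, hg⟩ := exists_act_eq W.elliptic W.degree
  exact ⟨g, M₂.ext hg.symm⟩

lemma continuous_orbitMap_apply : Continuous fun p : G × Torus => orbitMap p.1 p.2 := by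
  have h1 : Continuous fun p : G × Torus => (p.1.1, wpNormalized (p.2 - p.1.2.toAdd)) := by
    refine (continuous_fst.comp continuous_fst).prodMk (continuous_wpNormalized.comp ?_)
    exact continuous_snd.sub (continuous_toAdd.comp (continuous_snd.comp continuous_fst))
  exact continuous_moebius.comp h1

lemma M₂.dist_le {V W : M₂} {r : ℝ} (h : ∀ z, sphereDist (V z) (W z) ≤ r) : dist V W ≤ r :=
  ciSup_le h

lemma M₂.sphereDist_le (V W : M₂) (z : Torus) : sphereDist (V z) (W z) ≤ dist V W :=
  le_ciSup (bddAbove_sphereDist V W) z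

lemma continuous_sphereDist_orbitMap (g : G) :
    Continuous fun p : G × Torus => sphereDist (orbitMap p.1 p.2) (orbitMap g p.2) := by
  have h1 : Continuous fun p : G × Torus => orbitMap g p.2 :=
    continuous_orbitMap_apply.comp (f := fun p : G × Torus => (g, p.2))
      (continuous_const.prodMk continuous_snd)
  exact continuous_sphereDist.comp
    (f := fun p : G × Torus => (orbitMap p.1 p.2, orbitMap g p.2))
    (continuous_orbitMap_apply.prodMk h1)

/-- Compactness of the torus turns joint continuity into closeness uniform in z. -/
lemma eventually_sphereDist_lt (g : G) {ε : ℝ} (hε : 0 < ε) :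
    ∀ᶠ g' in 𝓝 g, ∀ z : Torus, sphereDist (orbitMap g' z) (orbitMap g z) < ε := by
  have h := (isCompact_univ (X := Torus)).eventually_forall_of_forall_eventually (x₀ := g)
    (P := fun g' z => sphereDist (orbitMap g' z) (orbitMap g z) < ε) (fun z _ => by
      have h0 : sphereDist (orbitMap g z) (orbitMap g z) < ε := by rwa [sphereDist_self]
      exact (continuous_sphereDist_orbitMap g).continuousAt.eventually_lt
        (x₀ := (g, z)) continuousAt_const h0)
  exact h.mono fun g' hg' z => hg' z (Set.mem_univ z)

lemma continuous_orbitMap : Continuous orbitMap := by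
  rw [continuous_iff_continuousAt]
  intro g
  rw [ContinuousAt, Metric.tendsto_nhds]
  intro ε hε
  refine (eventually_sphereDist_lt g (half_pos hε)).mono fun g' hg' => ?_
  exact (M₂.dist_le fun z => (hg' z).le).trans_lt (half_lt_self hε)

lemma tendsto_apply {l : Filter M₂} {W : M₂} (h : l ≤ 𝓝 W) (z : Torus) :
    Tendsto (fun V : M₂ => V z) l (𝓝 (W z)) := by
  apply tendsto_of_sphereDist
  have h1 : Tendsto (fun V : M₂ => dist V W) l (𝓝 0) :=
    (tendsto_iff_dist_tendsto_zero.1 tendsto_id).mono_left h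
  exact squeeze_zero (fun V => InnerProductGeometry.angle_nonneg _ _)
    (fun V => M₂.sphereDist_le V W z) h1

/-! ### Compactness of the set of matrices -/

lemma ofHomog_eq_of_cross {v w : ℂ × ℂ} (hv : v ≠ 0) (hw : w ≠ 0)
    (h : v.1 * w.2 = v.2 * w.1) : ofHomog v = ofHomog w := by
  by_cases h1 : v.2 = 0
  · have hx : v.1 ≠ 0 := fun hx => hv (Prod.ext hx h1)
    have h2 : w.2 = 0 := by simpa [h1, hx] using h
    rw [ofHomog_of_eq h1, ofHomog_of_eq h2]
  · have h2 : w.2 ≠ 0 := fun h2 => by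
      rw [h2, mul_zero] at h
      exact hw (Prod.ext ((mul_eq_zero.1 h.symm).resolve_left h1) h2)
    rw [ofHomog_of_ne h1, ofHomog_of_ne h2]
    congr 1
    rw [div_eq_div_iff h1 h2, h, mul_comm]

lemma linAct_smul (c : ℂ) (A : Matrix (Fin 2) (Fin 2) ℂ) (v : ℂ × ℂ) :
    linAct (c • A) v = c • linAct A v := by
  simp only [linAct, Matrix.smul_apply, smul_eq_mul, Prod.smul_mk]
  congr 1 <;> ring

/-- The cross product of Bv and Bw is det B times that of v and w, so a degenerate B sends
everything outside its kernel to one point. -/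
lemma ofHomog_linAct_of_det_eq_zero {B : Matrix (Fin 2) (Fin 2) ℂ} (hB : B.det = 0) {v w : ℂ × ℂ}
    (hv : linAct B v ≠ 0) (hw : linAct B w ≠ 0) :
    ofHomog (linAct B v) = ofHomog (linAct B w) := by
  refine ofHomog_eq_of_cross hv hw ?_
  rw [Matrix.det_fin_two] at hB
  simp only [linAct]
  linear_combination (v.1 * w.2 - v.2 * w.1) * hB

/-- The kernel of a nonzero matrix is at most a line, which meets the affine chart at most once. -/
lemma eq_of_linAct_eq_zero {B : Matrix (Fin 2) (Fin 2) ℂ} (hB : B ≠ 0) {x y : ℂ}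
    (hx : linAct B (x, 1) = 0) (hy : linAct B (y, 1) = 0) : x = y := by
  by_contra hne
  have hxy : x - y ≠ 0 := sub_ne_zero.2 hne
  have h1 : B 0 0 * x + B 0 1 * 1 = 0 := congrArg Prod.fst hx
  have h2 : B 1 0 * x + B 1 1 * 1 = 0 := congrArg Prod.snd hx
  have h3 : B 0 0 * y + B 0 1 * 1 = 0 := congrArg Prod.fst hy
  have h4 : B 1 0 * y + B 1 1 * 1 = 0 := congrArg Prod.snd hy
  have e1 : B 0 0 = 0 := by
    refine (mul_eq_zero.1 (?_ : B 0 0 * (x - y) = 0)).resolve_right hxy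
    linear_combination h1 - h3
  have e2 : B 1 0 = 0 := by
    refine (mul_eq_zero.1 (?_ : B 1 0 * (x - y) = 0)).resolve_right hxy
    linear_combination h2 - h4
  apply hB
  ext i j
  fin_cases i <;> fin_cases j
  · exact e1
  · simpa [e1] using h1
  · exact e2
  · simpa [e2] using h2

lemma tendsto_linAct {α : Type*} {l : Filter α} {M : α → Matrix (Fin 2) (Fin 2) ℂ}
    {B : Matrix (Fin 2) (Fin 2) ℂ} {v : α → ℂ × ℂ} {v₀ : ℂ × ℂ} (hM : Tendsto M l (𝓝 B))
    (hv : Tendsto v l (𝓝 v₀)) : Tendsto (fun a => linAct (M a) (v a)) l (𝓝 (linAct B v₀)) :=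
  (continuous_linAct.tendsto (B, v₀)).comp (hM.prodMk_nhds hv)

/-- If Möbius transforms of translates of `℘ / e₁` converge to an elliptic function of degree two,
then the rescaled matrices cannot degenerate in the limit. -/
lemma det_ne_zero_of_tendsto {α : Type*} {l : Filter α} [l.NeBot] {W : Torus → OnePoint ℂ}
    (hW : IsElliptic W) (h2 : HasDegree W 2) {A : α → SL2} {t : α → Torus} {τ : Torus}
    (ht : Tendsto t l (𝓝 τ)) {c : α → ℂ} (hc : ∀ a, c a ≠ 0)
    {B : Matrix (Fin 2) (Fin 2) ℂ} (hB : B ≠ 0) (hcA : Tendsto (fun a => c a • (A a).1) l (𝓝 B))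
    (hlim : ∀ z, Tendsto (fun a => moebiusSL (A a) (wpNormalized (z - t a))) l (𝓝 (W z))) :
    B.det ≠ 0 := by
  intro hdet
  set V := act (G.mk 1 τ) wpNormalized with hV
  have hVz : ∀ z, V z = wpNormalized (z - τ) := fun z => by
    simp [hV, act, G.mk]
  have hVfin := fibre_finite (isElliptic_wpNormalized.act (G.mk 1 τ))
    (hasDegree_wpNormalized.act (G.mk 1 τ) isElliptic_wpNormalized)
  -- Away from poles of `V` and the kernel of `B`, the limit can be computed in homogeneous
  -- coordinates, where the scalars `c` have no effect.
  have key : ∀ z x, V z = ((x : ℂ) : OnePoint ℂ) → linAct B (x, 1) ≠ 0 →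
      W z = ofHomog (linAct B (x, 1)) := by
    intro z x hx hne
    have hw : Tendsto (fun a => wpNormalized (z - t a)) l (𝓝 (x : OnePoint ℂ)) := by
      rw [← hx, hVz]
      have h0 : Tendsto (fun a => z - t a) l (𝓝 (z - τ)) := tendsto_const_nhds.sub ht
      exact (continuous_wpNormalized.tendsto (z - τ)).comp h0
    have hy : Tendsto (fun a => (wpNormalized (z - t a)).elim 0 id) l (𝓝 x) := by
      have : ContinuousAt (fun w : OnePoint ℂ => w.elim 0 id) (x : OnePoint ℂ) := by
        rw [OnePoint.continuousAt_coe]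
        exact continuousAt_id
      exact this.tendsto.comp hw
    have h1 : Tendsto (fun a => linAct (c a • (A a).1) ((wpNormalized (z - t a)).elim 0 id, 1)) l
        (𝓝 (linAct B (x, 1))) :=
      tendsto_linAct hcA (hy.prodMk_nhds tendsto_const_nhds)
    have h3 := (continuousAt_ofHomog hne).tendsto.comp h1
    refine tendsto_nhds_unique (hlim z) (h3.congr' ?_)
    filter_upwards [hw.eventually eventually_ne_infty] with a ha
    obtain ⟨y, hy⟩ := OnePoint.ne_infty_iff_exists.1 ha
    have e : ofHomog (y, 1) = (y : OnePoint ℂ) := by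
      rw [ofHomog_of_ne one_ne_zero, div_one]
    rw [Function.comp_apply, ← hy, OnePoint.elim_some, id, linAct_smul, ofHomog_smul (hc a), ← e,
      moebiusSL_ofHomog _ (by simp)]
  -- The kernel of `B` contains at most one finite value, so the exceptional points lie in a single
  -- fibre of `V`.
  have hbad : {z | ∃ x : ℂ, V z = x ∧ linAct B (x, 1) = 0}.Finite := by
    by_cases hex : ∃ x : ℂ, linAct B (x, 1) = 0
    · obtain ⟨x, hx⟩ := hex
      refine (hVfin (x : OnePoint ℂ)).subset ?_
      rintro z ⟨y, hy, hy0⟩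
      rw [eq_of_linAct_eq_zero hB hx hy0]
      exact hy
    · refine Set.finite_empty.subset ?_
      rintro z ⟨y, -, hy0⟩
      exact hex ⟨y, hy0⟩
  have hcof := ((hVfin OnePoint.infty).union hbad).infinite_compl
  have hgood : ∀ z ∈ ({z | V z = OnePoint.infty} ∪
      {z | ∃ x : ℂ, V z = x ∧ linAct B (x, 1) = 0})ᶜ,
      ∃ x : ℂ, linAct B (x, 1) ≠ 0 ∧ W z = ofHomog (linAct B (x, 1)) := by
    intro z hz
    rw [Set.mem_compl_iff, Set.mem_union, not_or] at hz
    obtain ⟨x, hx⟩ := OnePoint.ne_infty_iff_exists.1 hz.1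
    have hne : linAct B (x, 1) ≠ 0 := fun h => hz.2 ⟨x, hx.symm, h⟩
    exact ⟨x, hne, key z x hx.symm hne⟩
  obtain ⟨z₀, hz₀⟩ := hcof.nonempty
  obtain ⟨x₀, hx₀, hW₀⟩ := hgood z₀ hz₀
  -- All points outside a finite set share one value of `W`, and the torus is infinite, which
  -- contradicts finiteness of the fibres.
  refine hcof ((fibre_finite hW h2 (W z₀)).subset fun z hz => ?_)
  obtain ⟨x, hx, hWz⟩ := hgood z hz
  change W z = W z₀
  rw [hWz, hW₀, ofHomog_linAct_of_det_eq_zero hdet hx hx₀]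

/-- A sequence in `SL(2, ℂ)` whose rescalings accumulate only at invertible matrices converges
along ultrafilters. -/
lemma exists_tendsto_SL2 {α : Type*} (U : Ultrafilter α) (A : α → SL2)
    (h : ∀ (c : α → ℂ) (B : Matrix (Fin 2) (Fin 2) ℂ), (∀ a, c a ≠ 0) → B ≠ 0 →
      Tendsto (fun a => c a • (A a).1) U (𝓝 B) → B.det ≠ 0) :
    ∃ A₀ : SL2, Tendsto A U (𝓝 A₀) := by
  let m : α → (Fin 2 → Fin 2 → ℂ) := fun a => (A a).1
  have hm0 : ∀ a, m a ≠ 0 := fun a h0 => by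
    have := (A a).2
    rw [show (A a).1 = 0 from h0, Matrix.det_zero] at this
    exact zero_ne_one this
  -- Rescaling to norm one brings the matrices to a compact sphere, where the ultrafilter has a
  -- nonzero limit.
  let c : α → ℂ := fun a => ((‖m a‖⁻¹ : ℝ) : ℂ)
  have hc : ∀ a, c a ≠ 0 := fun a => by
    simp only [c, ne_eq, Complex.ofReal_eq_zero, inv_eq_zero, norm_eq_zero]
    exact hm0 a
  have hsph : ∀ a, c a • m a ∈ Metric.sphere (0 : Fin 2 → Fin 2 → ℂ) 1 := fun a => by
    rw [mem_sphere_zero_iff_norm, norm_smul]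
    simp only [c, Complex.norm_real, norm_inv, norm_norm]
    exact inv_mul_cancel₀ (norm_ne_zero_iff.2 (hm0 a))
  obtain ⟨b, hb, hbU⟩ := (isCompact_sphere (0 : Fin 2 → Fin 2 → ℂ) 1).ultrafilter_le_nhds
    (U.map fun a => c a • m a) (by
      rw [le_principal_iff, Ultrafilter.coe_map, mem_map]
      exact Filter.univ_mem' hsph)
  let B : Matrix (Fin 2) (Fin 2) ℂ := b
  have hlim : Tendsto (fun a => c a • (A a).1) U (𝓝 B) := hbU
  have hB : B ≠ 0 := fun h0 => by
    have h1 : b = 0 := h0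
    rw [h1] at hb
    simp at hb
  have hdet := h c B hc hB hlim
  have hdlim : Tendsto (fun a => (c a • (A a).1).det) U (𝓝 B.det) :=
    ((Continuous.matrix_det continuous_id).tendsto B).comp hlim
  have hcdet : ∀ a, (c a • (A a).1).det = c a ^ 2 := fun a => by
    rw [Matrix.det_smul, (A a).2, Fintype.card_fin, mul_one]
  simp only [hcdet] at hdlim
  -- The rescaled determinant is c², and c is a positive real, so c is recovered from it without
  -- ambiguity of square root; hence c⁻¹ converges.
  have hcinv : ∀ a, (((Real.sqrt ‖c a ^ 2‖)⁻¹ : ℝ) : ℂ) = (c a)⁻¹ := fun a => by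
    rw [norm_pow, Real.sqrt_sq (norm_nonneg _)]
    simp only [c, Complex.norm_real, norm_inv, norm_norm, Complex.ofReal_inv]
  have h1 : Tendsto (fun a => (c a)⁻¹) U (𝓝 (((Real.sqrt ‖B.det‖)⁻¹ : ℝ) : ℂ)) := by
    simp only [← hcinv]
    have h0 : Real.sqrt ‖B.det‖ ≠ 0 := (Real.sqrt_pos.2 (norm_pos_iff.2 hdet)).ne'
    exact (Complex.continuous_ofReal.tendsto _).comp
      (((Real.continuous_sqrt.tendsto _).comp hdlim.norm).inv₀ h0)
  have h2 : Tendsto (fun a => (A a).1) U (𝓝 ((((Real.sqrt ‖B.det‖)⁻¹ : ℝ) : ℂ) • B)) := by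
    refine (h1.smul hlim).congr fun a => ?_
    rw [smul_smul, inv_mul_cancel₀ (hc a), one_smul]
  have h3 : ((((Real.sqrt ‖B.det‖)⁻¹ : ℝ) : ℂ) • B).det = 1 := by
    have h4 := ((Continuous.matrix_det continuous_id).tendsto _).comp h2
    refine tendsto_nhds_unique h4 (tendsto_const_nhds.congr fun a => ?_)
    exact (A a).2.symm
  exact ⟨⟨_, h3⟩, tendsto_subtype_rng.2 h2⟩

/-! ### The homeomorphism -/

/-- Properness of the orbit map: every section, continuous or not, converges along an ultrafilter
that converges in `M₂`. -/
lemma exists_tendsto_of_orbitMap {s : M₂ → G} (hs : ∀ V, orbitMap (s V) = V) (U : Ultrafilter M₂)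
    {W : M₂} (hU : ↑U ≤ 𝓝 W) : ∃ g, Tendsto s U (𝓝 g) := by
  choose A hA using fun V => QuotientGroup.mk_surjective (s V).1
  have hAs : ∀ V z, moebiusSL (A V) (wpNormalized (z - (s V).2.toAdd)) = V z := fun V z => by
    rw [← moebius_mk, hA, ← orbitMap_apply, hs]
  obtain ⟨τ, -, hτ⟩ := (isCompact_univ (X := Torus)).ultrafilter_le_nhds
    (U.map fun V => (s V).2.toAdd) (by simp)
  have ht : Tendsto (fun V => (s V).2.toAdd) U (𝓝 τ) := hτ
  obtain ⟨A₀, hA₀⟩ := exists_tendsto_SL2 U A fun c B hc hB hlim =>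
    det_ne_zero_of_tendsto W.elliptic W.degree ht hc hB hlim fun z => by
      simp only [hAs]
      exact tendsto_apply hU z
  refine ⟨(QuotientGroup.mk A₀, Multiplicative.ofAdd τ), ?_⟩
  have h1 : Tendsto (fun V => (QuotientGroup.mk (A V) : PSL2)) U (𝓝 (QuotientGroup.mk A₀)) :=
    (continuous_quot_mk.tendsto A₀).comp hA₀
  simp only [hA] at h1
  have h2 : Tendsto (fun V => (s V).2) U (𝓝 (Multiplicative.ofAdd τ)) :=
    (continuous_ofAdd.tendsto τ).comp ht
  exact h1.prodMk_nhds h2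

/-- The map induced by the orbit map on the space of left cosets. -/
def cosetMap : G ⧸ G₀ → M₂ :=
  Quotient.lift orbitMap fun g h hgh => (orbitMap_eq_iff g h).2 (QuotientGroup.leftRel_apply.1 hgh)

lemma cosetMap_bijective : Function.Bijective cosetMap := by
  constructor
  · intro x y
    induction x using QuotientGroup.induction_on
    induction y using QuotientGroup.induction_on
    intro h
    exact QuotientGroup.eq.2 ((orbitMap_eq_iff _ _).1 h)
  · intro W
    obtain ⟨g, hg⟩ := orbitMap_surjective W
    exact ⟨QuotientGroup.mk g, hg⟩

lemma continuous_cosetMap : Continuous cosetMap := continuous_orbitMap.quotient_lift _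

/-- The homeomorphism from the space of left cosets of the stabilizer to `M₂`. -/
def cosetHomeomorph : (G ⧸ G₀) ≃ₜ M₂ where
  toEquiv := Equiv.ofBijective cosetMap cosetMap_bijective
  continuous_toFun := continuous_cosetMap
  continuous_invFun := by
    set e := Equiv.ofBijective cosetMap cosetMap_bijective with he
    change Continuous e.symm
    choose s hs using orbitMap_surjective
    have hes : ∀ V, e.symm V = QuotientGroup.mk (s V) := fun V => by
      rw [Equiv.symm_apply_eq]
      exact (hs V).symm
    -- Along an ultrafilter tending to `W` the chosen preimages tend to some `g`. Continuity of the
    -- orbit map places `g` over `W`, so its coset is the required limit.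
    rw [continuous_iff_ultrafilter]
    intro W U hU
    obtain ⟨g, hg⟩ := exists_tendsto_of_orbitMap hs U hU
    have h1 : Tendsto e.symm U (𝓝 (QuotientGroup.mk g)) := by
      simp only [funext hes]
      exact (continuous_quot_mk.tendsto g).comp hg
    have h2 : orbitMap g = W := by
      have h3 := (continuous_orbitMap.tendsto g).comp hg
      have h4 : orbitMap ∘ s = id := funext hs
      rw [h4] at h3
      exact tendsto_nhds_unique h3 (tendsto_id.mono_left hU)
    have h5 : e.symm W = QuotientGroup.mk g := by
      rw [Equiv.symm_apply_eq]
      exact h2.symm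
    rw [h5]
    exact h1

end EllipticModuli
end

open EllipticModuli in
theorem theorem1 :
    IsKleinFour G₀ ∧
    (∀ g : G, act g wpNormalized = wpNormalized ↔ g ∈ G₀) ∧
    ∃ φ : (G ⧸ G₀) ≃ₜ M₂, ∀ (M : PSL2) (s z : Torus),
      φ (QuotientGroup.mk (G.mk M s)) z = moebius M (wpNormalized (z - s)) :=
  ⟨isKleinFour_G₀, act_wpNormalized_eq_iff, cosetHomeomorph, fun _ _ _ => rfl⟩
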